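/- Let $N\ge 1$, let $\eta,\lambda\in\mathbb C$, put $q=e^{\eta}$, $q^{u}=e^{\eta u}$ and $[u]=\frac{q^{u}-q^{-u}}{q-q^{-1}}$, and assume $q^2\neq 1$ and $[k]\ne 0$ for $k=2,\dots,N$. **Dyck paths.** A Dyck path of length $N$ is a sequence of integers $\alpha=(\alpha_0,\dots,\alpha_N)$ with $\alpha_i\ge 0$, $\alpha_{i+1}-\alpha_i=\pm1$, $\alpha_0=0$, and $\alpha_N=0$ for $N$ even, $\alpha_N=1$ for $N$ odd. The maximal Dyck path $\Omega=\Omega^{\rm A}$ is $\Omega_i=\min(i,2n-i)$ with $n=\lfloor (N+1)/2\rfloor$. On the space with basis $|\alpha\rangle$, $\alpha$ a Dyck path, the Temperley–Lieb generators $e_i$, $1\le i\le N-1$, act as follows. * If $\alpha$ has a local minimum at $i$, then $e_i|\alpha\rangle$ is the path obtained by raising $\alpha_i$ by $2$. * If $\alpha$ has a local maximum at $i$, then $e_i|\alpha\rangle=-[2]\,|\alpha\rangle$. * If $\alpha_{i-1}<\alpha_i<\alpha_{i+1}$, let $j>i$ be such that $\alpha_j=\alpha_i$ and $\alpha_l>\alpha_i$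 for $i<l<j$; then $e_i|\alpha\rangle$ is the path obtained by lowering all $\alpha_l$, $i<l<j$, by $2$. * If $\alpha_{i-1}>\alpha_i>\alpha_{i+1}$, let $k<i$ be such that $\alpha_k=\alpha_i$ and $\alpha_l>\alpha_i$ for $k<l<i$; then $e_i|\alpha\rangle$ is the path obtained by lowering all $\alpha_l$, $k<l<i$, by $2$. Let $R_i(u)=\frac{[1-u]-[u]e_i}{[1+u]}$. **qKZ equation.** Let $U\subseteq\mathbb C^N$ be stable under the exchanges $\sigma_i$ of $x_i$ and $x_{i+1}$ ($1\le i\le N-1$), under $x_1\mapsto -x_1$ and under $x_N\mapsto-\lambda-x_N$, and such that $[x_i-x_j]\neq0$ and $[1+x_i-x_j]\ne0$ on $U$ for all $i\ne j$. Let $|\Psi(x)\rangle=\sum_\alpha\psi_\alpha(x)|\alpha\rangle$ solve the qKZ equation of type A on $U$, that is, for all $x\in U$, $$R_i(x_i-x_{i+1})|\Psi(x)\rangle=|\Psi(\sigma_i x)\rangle\quad(1\le i\le N-1),$$ $$|\Psi(x_1,\dots,x_N)\rangle=|\Psi(-x_1,x_2,\dots,x_N)\rangle=|\Psi(x_1,\dots,x_{N-1},-\lambda-x_N)\rangle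 .$$ **Operators.** For a function $\psi$ of $x$ put $(\pi_i\psi)(x)=\psi(\sigma_i x)$, $$a_i\psi=\frac{[x_i-x_{i+1}+1]}{[x_i-x_{i+1}]}\,\pi_i\psi+\frac{[x_i-x_{i+1}-1]}{[x_i-x_{i+1}]}\,\psi ,\qquad h_i(u)=\frac{[u+1]}{[u]}-a_i$$ (the Baxterised Demazure–Lusztig operators). **Tiles.** For a Dyck path $\alpha$ the added tiles are the pairs $(i,j)$ with $1\le i\le N-1$, $i+j$ odd and $\alpha_i<j<\Omega_i$; they form the Young diagram between $\alpha$ and $\Omega$. The content $u_{i,j}$ of an added tile is $1$ if neither $(i+1,j-1)$ nor $(i-1,j-1)$ is an added tile, and otherwise it is $1$ plus the maximum of the contents of those of these two that are added tiles. (Equivalently, remove successively all corner tiles; $u_{i,j}$ is the number of the step at which the tile is removed.) **Theorem.** For every Dyck path $\alpha$ of length $N$ one has, on $U$, $$\psi_\alpha=H_\alpha\,\psi_{\Omega},\qquad H_\alpha=\prod_{(i,j)}h_i(u_{i,j}),$$ where the product is over all added tiles, ordered in such a way that the contents $u_{i,j}$ do not decrease when reading from left to right; such an ordering exists, and the equality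 holds for each such ordering. -/

import Mathlib

noncomputable section

namespace QKZ

/-! ### Numbers `[u]`, with `q = exp η` and `q ^ u = exp (η * u)` -/

/-- `[u] = (q ^ u - q ^ (-u)) / (q - q⁻¹)` where `q = exp η`. -/
def qnum (η u : ℂ) : ℂ :=
  (Complex.exp (η * u) - Complex.exp (-(η * u))) / (Complex.exp η - Complex.exp (-η))

/-! ### Dyck paths -/

/-- Dyck paths of length `N`: they end at height `0` for `N` even and at height `1` for `N` odd. -/
@[ext]
structure DyckPath (N : ℕ) where
  height : Fin (N + 1) → ℤ
  start : height 0 = 0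
  finish : height (Fin.last N) = ((N % 2 : ℕ) : ℤ)
  nonneg : ∀ i, 0 ≤ height i
  step : ∀ i : Fin N, height i.succ = height i.castSucc + 1 ∨
    height i.succ = height i.castSucc - 1

/-- The maximal Dyck path `(0, 1, …, n, n - 1, …)`, `n = ⌊(N + 1) / 2⌋`. -/
def maxPath (N : ℕ) : DyckPath N where
  height i := min (i : ℤ) (2 * (((N + 1) / 2 : ℕ) : ℤ) - (i : ℤ))
  start := by
    simp only [Fin.val_zero]
    omega
  finish := by
    simp only [Fin.val_last]
    omega
  nonneg i := by
    have := i.isLt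
    omega
  step i := by
    have := i.isLt
    simp only [Fin.val_succ, Fin.val_castSucc]
    omega

/-! The system has `N = m + 1` sites. The index `i : Fin m` stands for the generator number
`i + 1`, with `1 ≤ i + 1 ≤ N - 1`; it acts at the position `i + 1` of a path and on the
variables number `i + 1` and `i + 2`, which are the coordinates `i.castSucc` and `i.succ`. -/

/-- The position at which the generator with index `i` acts. -/
def pos {m : ℕ} (i : Fin m) : Fin (m + 2) := i.succ.castSucc

/-- The path has a local minimum at the position of `i`. -/
def IsLocMin {m : ℕ} (α : DyckPath (m + 1)) (i : Fin m) : Prop :=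
  α.height i.castSucc.castSucc = α.height (pos i) + 1 ∧
    α.height i.succ.succ = α.height (pos i) + 1

/-- The path has a local maximum at the position of `i`. -/
def IsLocMax {m : ℕ} (α : DyckPath (m + 1)) (i : Fin m) : Prop :=
  α.height i.castSucc.castSucc = α.height (pos i) - 1 ∧
    α.height i.succ.succ = α.height (pos i) - 1

theorem one_le_of_slope {m : ℕ} (α : DyckPath (m + 1)) (i : Fin m)
    (hmin : ¬ IsLocMin α i) (hmax : ¬ IsLocMax α i) : 1 ≤ α.height (pos i) := by
  have h1 := α.step i.castSucc
  have h2 := α.step i.succ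
  have h3 := α.nonneg i.castSucc.castSucc
  have h4 := α.nonneg i.succ.succ
  have e : i.castSucc.succ = pos i := rfl
  have e' : i.succ.castSucc = pos i := rfl
  rw [e] at h1
  rw [e'] at h2
  unfold IsLocMin at hmin
  unfold IsLocMax at hmax
  omega

open Classical in
/-- A local minimum is raised by two: one tile is added. -/
def raise {m : ℕ} (α : DyckPath (m + 1)) (i : Fin m) (hmin : IsLocMin α i) :
    DyckPath (m + 1) where
  height l := if l = pos i then α.height l + 2 else α.height l
  start := by
    have : (0 : Fin (m + 2)) ≠ pos i := by
      simp [pos, Fin.ext_iff]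
    simp [this, α.start]
  finish := by
    have : Fin.last (m + 1) ≠ pos i := by
      have := i.isLt
      simp only [pos, ne_eq, Fin.ext_iff, Fin.val_last, Fin.val_castSucc, Fin.val_succ]
      omega
    simp only [this, if_false, α.finish]
  nonneg l := by
    have := α.nonneg l
    split_ifs <;> omega
  step k := by
    have hs := α.step k
    obtain ⟨hl, hr⟩ := hmin
    by_cases h1 : k.succ = pos i
    · have h2 : k.castSucc = i.castSucc.castSucc := by
        simp only [pos, Fin.ext_iff, Fin.val_castSucc, Fin.val_succ] at h1 ⊢
        omega
      have h3 : i.castSucc.castSucc ≠ pos i := by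
        simp [pos, Fin.ext_iff]
      simp only [h1, h2, h3, if_true, if_false]
      omega
    · by_cases h2 : k.castSucc = pos i
      · have h3 : k.succ = i.succ.succ := by
          simp only [pos, Fin.ext_iff, Fin.val_castSucc, Fin.val_succ] at h2 ⊢
          omega
        rw [h3] at h1
        simp only [h2, h3, h1, if_true, if_false]
        omega
      · simp only [h1, h2, if_false]
        exact hs

/-- The position `l` belongs to the excursion of the path above the height of the position of `i`
that starts at that position: the path stays strictly above that height from there up to and
including `l`, to the right or to the left. If the path goes uphill at `i`, these `l` are those
with `i < l < j`, where `j` is the first return to the height at `i` to the right; if it goes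
downhill at `i`, they are those with `k < l < i`, where `k` is the last visit to that height to
the left. -/
def InExcursion {m : ℕ} (α : DyckPath (m + 1)) (i : Fin m) (l : Fin (m + 2)) : Prop :=
  l ≠ pos i ∧ ∀ k ∈ Set.uIcc (pos i) l, k ≠ pos i → α.height (pos i) < α.height k

open Classical in
/-- On a slope, the layer of tiles below the excursion is peeled off: all the heights of the
excursion are lowered by two. -/
def peel {m : ℕ} (α : DyckPath (m + 1)) (i : Fin m) (h : 1 ≤ α.height (pos i)) :
    DyckPath (m + 1) where
  height l := if InExcursion α i l then α.height l - 2 else α.height l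
  start := by
    have : ¬ InExcursion α i 0 := fun hE => by
      have h1 := hE.2 0 Set.right_mem_uIcc hE.1
      have h2 := α.start
      omega
    simp only [this, if_false, α.start]
  finish := by
    have : ¬ InExcursion α i (Fin.last (m + 1)) := fun hE => by
      have h1 := hE.2 _ Set.right_mem_uIcc hE.1
      have h2 := α.finish
      omega
    simp only [this, if_false, α.finish]
  nonneg l := by
    have h0 := α.nonneg l
    split_ifs with hE
    · have h1 := hE.2 l Set.right_mem_uIcc hE.1
      omega
    · exact h0
  step k := by
    have hs := α.step k
    have hlt : k.castSucc < k.succ := Fin.castSucc_lt_succ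
    by_cases h1 : InExcursion α i k.castSucc <;> by_cases h2 : InExcursion α i k.succ
    · simp only [h1, h2, if_true]; omega
    · simp only [h1, h2, if_true, if_false]
      have g1 := h1.2 _ Set.right_mem_uIcc h1.1
      suffices α.height k.succ ≤ α.height (pos i) by omega
      by_contra hc
      apply h2
      refine ⟨fun e => by rw [e] at hc; omega, fun t ht hne => ?_⟩
      by_cases et : t = k.succ
      · rw [et]; omega
      · apply h1.2 t _ hne
        have hp := h1.1
        rw [Set.mem_uIcc] at ht ⊢
        simp only [ne_eq, Fin.ext_iff, Fin.le_def, Fin.val_castSucc, Fin.val_succ] at *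
        omega
    · simp only [h1, h2, if_true, if_false]
      have g1 := h2.2 _ Set.right_mem_uIcc h2.1
      suffices α.height k.castSucc ≤ α.height (pos i) by omega
      by_contra hc
      apply h1
      refine ⟨fun e => by rw [e] at hc; omega, fun t ht hne => ?_⟩
      by_cases et : t = k.castSucc
      · rw [et]; omega
      · apply h2.2 t _ hne
        have hp := h2.1
        rw [Set.mem_uIcc] at ht ⊢
        simp only [ne_eq, Fin.ext_iff, Fin.le_def, Fin.val_castSucc, Fin.val_succ] at *
        omega
    · simp only [h1, h2, if_false]; exact hs

/-! ### The Dyck path representation of the Temperley-Lieb algebra -/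

/-- The space spanned by the states `|α⟩`. -/
abbrev States (m : ℕ) : Type := DyckPath (m + 1) →₀ ℂ

open Classical in
/-- The vector `e_i |α⟩`. -/
def tlOnPath {m : ℕ} (η : ℂ) (i : Fin m) (α : DyckPath (m + 1)) : States m :=
  if hmin : IsLocMin α i then Finsupp.single (raise α i hmin) 1
  else if hmax : IsLocMax α i then Finsupp.single α (-qnum η 2)
  else Finsupp.single (peel α i (one_le_of_slope α i hmin hmax)) 1

/-- The Temperley-Lieb generator `e_i` on the Dyck path representation. -/
def tlGen {m : ℕ} (η : ℂ) (i : Fin m) : Module.End ℂ (States m) :=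
  Finsupp.linearCombination ℂ (tlOnPath η i)

/-- `R_i(u) = ([1 - u] - [u] e_i) / [1 + u]`. -/
def rMatrix {m : ℕ} (η : ℂ) (i : Fin m) (u : ℂ) : Module.End ℂ (States m) :=
  (qnum η (1 + u))⁻¹ • (qnum η (1 - u) • (1 : Module.End ℂ (States m)) - qnum η u • tlGen η i)

/-! ### Action on the variables and the qKZ equation -/

/-- Exchange of the variables number `i + 1` and `i + 2`. -/
def exchange {m : ℕ} (i : Fin m) (x : Fin (m + 1) → ℂ) : Fin (m + 1) → ℂ :=
  x ∘ Equiv.swap i.castSucc i.succ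

/-- `x_1 ↦ -x_1`. -/
def reflectFirst {m : ℕ} (x : Fin (m + 1) → ℂ) : Fin (m + 1) → ℂ :=
  Function.update x 0 (-x 0)

/-- `x_N ↦ -lam - x_N`. -/
def reflectLast {m : ℕ} (lam : ℂ) (x : Fin (m + 1) → ℂ) : Fin (m + 1) → ℂ :=
  Function.update x (Fin.last m) (-lam - x (Fin.last m))

/-- `U` is a set of values of the variables on which the qKZ equation makes sense: it is stable
under the exchanges and the two reflections, and no denominator `[x_i - x_j]` or
`[1 + x_i - x_j]` vanishes on it. -/
structure IsAdmissibleDomain {m : ℕ} (η lam : ℂ) (U : Set (Fin (m + 1) → ℂ)) : Prop where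
  exchange_mem : ∀ (i : Fin m), ∀ x ∈ U, exchange i x ∈ U
  reflectFirst_mem : ∀ x ∈ U, reflectFirst x ∈ U
  reflectLast_mem : ∀ x ∈ U, reflectLast lam x ∈ U
  sub_ne : ∀ x ∈ U, ∀ i j, i ≠ j → qnum η (x i - x j) ≠ 0
  one_add_sub_ne : ∀ x ∈ U, ∀ i j, i ≠ j → qnum η (1 + (x i - x j)) ≠ 0

/-- The qKZ equation of type A on `U`; the component `ψ_α` of the vector-valued function `Ψ` is
`fun x => Ψ x α`. -/
structure IsQKZSolution {m : ℕ} (η lam : ℂ) (U : Set (Fin (m + 1) → ℂ))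
    (Ψ : (Fin (m + 1) → ℂ) → States m) : Prop where
  bulk : ∀ (i : Fin m), ∀ x ∈ U,
    rMatrix η i (x i.castSucc - x i.succ) (Ψ x) = Ψ (exchange i x)
  left : ∀ x ∈ U, Ψ x = Ψ (reflectFirst x)
  right : ∀ x ∈ U, Ψ x = Ψ (reflectLast lam x)

/-! ### Operators on functions of the variables -/

/-- The operator
`a_i ψ = ([x_i - x_{i+1} + 1] / [x_i - x_{i+1}]) π_i ψ + ([x_i - x_{i+1} - 1] / [x_i - x_{i+1}]) ψ`
where `π_i` exchanges `x_i` and `x_{i+1}`; `q - a_i` is the Demazure-Lusztig operator. -/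
def aOp {m : ℕ} (η : ℂ) (i : Fin m) : Module.End ℂ ((Fin (m + 1) → ℂ) → ℂ) where
  toFun ψ x :=
    qnum η (x i.castSucc - x i.succ + 1) / qnum η (x i.castSucc - x i.succ) * ψ (exchange i x) +
    qnum η (x i.castSucc - x i.succ - 1) / qnum η (x i.castSucc - x i.succ) * ψ x
  map_add' ψ φ := by
    funext x
    simp only [Pi.add_apply]
    ring
  map_smul' c ψ := by
    funext x
    simp only [Pi.smul_apply, smul_eq_mul, RingHom.id_apply]
    ring

/-- The Baxterised element `h_i(u) = [u + 1] / [u] - a_i`. -/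
def hOp {m : ℕ} (η : ℂ) (i : Fin m) (u : ℂ) : Module.End ℂ ((Fin (m + 1) → ℂ) → ℂ) :=
  (qnum η (u + 1) / qnum η u) • (1 : Module.End ℂ ((Fin (m + 1) → ℂ) → ℂ)) - aOp η i

/-! ### Tiles between a path and the maximal path, and the factorised operator -/

/-- There is a tile centred at the position of `i` and at height `j` between the path `α` and the
maximal path. Such a tile covers the heights from `j - 1` to `j + 1` at its position, so `j` has
the parity opposite to that of the heights of the paths there. -/
def IsTile {m : ℕ} (α : DyckPath (m + 1)) (i : Fin m) (j : ℕ) : Prop :=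
  Even ((i : ℕ) + j) ∧ α.height (pos i) < (j : ℤ) ∧ (j : ℤ) < (maxPath (m + 1)).height (pos i)

open Classical in
/-- The content `u_{i,j}` of the tile at the position of `i` and at height `j`: it is
`max {u_{i+1,j-1}, u_{i-1,j-1}} + 1`, where tiles that are not there count as `0`, so that it
is `1` if neither of the two is there. -/
def content {m : ℕ} (α : DyckPath (m + 1)) : ℕ → Fin m → ℕ
  | 0, _ => 0
  | j + 1, i =>
    if IsTile α i (j + 1) then
      ((Finset.univ.filter fun k : Fin m =>
        (k : ℕ) = (i : ℕ) + 1 ∨ (i : ℕ) = (k : ℕ) + 1).sup fun k => content α j k) + 1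
    else 0

/-- `L` lists every tile between `α` and the maximal path exactly once, and the contents do not
decrease along `L`. -/
structure IsTileOrder {m : ℕ} (α : DyckPath (m + 1)) (L : List (Fin m × ℕ)) : Prop where
  nodup : L.Nodup
  mem_iff : ∀ t : Fin m × ℕ, t ∈ L ↔ IsTile α t.1 t.2
  sorted : L.Pairwise fun s t => content α s.2 s.1 ≤ content α t.2 t.1

/-- The factorised operator: the product, in the order of the list `L` of tiles, of the operators
`h_i(u_{i,j})`. -/
def factorisedOp {m : ℕ} (η : ℂ) (α : DyckPath (m + 1)) (L : List (Fin m × ℕ)) :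
    Module.End ℂ ((Fin (m + 1) → ℂ) → ℂ) :=
  (L.map fun t => hOp η t.1 (content α t.2 t.1 : ℂ)).prod

end QKZ

end

/-!
The components of a solution are related to each other by the operators `a_i`. Reading off the
coefficient of a path in `e_i Ψ = -a_i Ψ`, which is the bulk equation solved for `e_i Ψ`, gives
`a_i ψ_α = 0` when `α` has no local maximum at `i`, and, when it has one,
`h_i(1) ψ_α = ∑ ψ_β` over the paths `β ≠ α` with `e_i |β⟩ = |α⟩`.

The formula is proved by induction on the area between `α` and the maximal path. Let `i` be a
*highest* local minimum of `α`, at height `h`, let `l` and `r` be the lengths of the slopes to its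
left and right, and let `γ` be the path obtained by filling the `l × r` rectangle spanned by these
slopes (`IsFilling`). As the minimum is a highest one, beyond its slopes `α` goes down at least as
far as it had come up. This has two consequences. First, the contents outside the rectangle do not
depend on what is removed inside it (`IsFilling.contentAt_outside`), so that
`H_α ψ_Ω = H_rect ψ_γ`, where `H_rect` is the product over the rectangle, in which the tile in row
`a` and column `b` has content `a + b + 1`. Second, `h_i(1) ψ_{α⁺} = ψ_α + ψ_β + ψ_β'`, where `α⁺`
is `α` with a tile on the minimum, and `β`, `β'` have one further tile, to the right or to the left
(`tlGen_apply_raise`).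

It remains to show `ψ_α = H_rect ψ_γ`. Both sides are annihilated by all the `a_j` of the interval
`(i - l, i + r)`: for `ψ_α` this is the shape of `α`, and for the other side it is fusion, a
consequence of the Yang-Baxter equation (`IsHeckeFamily.apply_rectBoxes_eq_zero`). Therefore the
Jones-Wenzl element `P` of this interval (`IsHeckeFamily.exists_jonesWenzl`), which satisfies
`P a_j = 0`, multiplies both sides by the same scalar `κ ≠ 0`, and it is enough to compare their
images under `P`. Now `P h_j(u) = ([u + 1] / [u]) P`, so by the induction hypothesis for `α⁺`, `β`
and `β'` both images are multiples of `P ψ_γ`, the factors being products of the ratios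
`[u + 1] / [u]` over the contents. The equality of the two factors comes down to
`[l + r] = [l + 1] [r] - [l] [r - 1]` (`rectWeight_relation`).

Two devices keep the combinatorics uniform. Heights, generators, tiles and contents are indexed by
`ℤ`, with paths continued downwards on both sides (`hz`), and boxes that are not tiles are allowed
in products, with content `0` and the factor `1`. Any two admissible orders of the tiles give the
same product, since tiles in the same or in neighbouring columns are ordered by height in both of
them (`contentAt_lt`), and the other factors commute.
-/

noncomputable section

namespace QKZ

/-! ### The numbers `[u]` -/

theorem qnum_add (η a b : ℂ) :
    qnum η (a + b) = qnum η (a + 1) * qnum η b - qnum η a * qnum η (b - 1) := by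
  unfold qnum
  have e1 : η * (a + b) = η * a + η * b := by ring
  have e2 : η * (a + 1) = η * a + η := by ring
  have e3 : η * (b - 1) = η * b - η := by ring
  rw [e1, e2, e3]
  simp only [Complex.exp_add, Complex.exp_neg, Complex.exp_sub]
  have h1 := Complex.exp_ne_zero (η * a)
  have h2 := Complex.exp_ne_zero (η * b)
  have h3 := Complex.exp_ne_zero η
  generalize Complex.exp (η * a) = A at *
  generalize Complex.exp (η * b) = B at *
  generalize Complex.exp η = E at *
  by_cases hk : E - E⁻¹ = 0
  · simp [hk]
  · rw [div_mul_div_comm, div_mul_div_comm, ← sub_div, div_eq_div_iff hk (mul_ne_zero hk hk)]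
    field_simp
    ring

theorem qnum_zero (η : ℂ) : qnum η 0 = 0 := by simp [qnum]

theorem qnum_one {η : ℂ} (h : qnum η 2 ≠ 0) : qnum η 1 = 1 := by
  have hk : Complex.exp η - Complex.exp (-η) ≠ 0 := by
    intro hk
    simp [qnum, hk] at h
  simp only [qnum, mul_one]
  exact div_self hk

/-- The ratio `[u + 1] / [u]`, the value of `h_i(u)` on the kernel of `a_i`. -/
def ratio (η : ℂ) (u : ℕ) : ℂ := qnum η ((u : ℂ) + 1) / qnum η (u : ℂ)

theorem ratio_one {η : ℂ} (h : qnum η 2 ≠ 0) : ratio η 1 = qnum η 2 := by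
  have : ((1 : ℕ) : ℂ) + 1 = 2 := by norm_num
  rw [ratio, this, Nat.cast_one, qnum_one h, div_one]

theorem ratio_mul {η : ℂ} {u : ℕ} (h0 : qnum η (u : ℂ) ≠ 0)
    (h1 : qnum η ((u : ℂ) + 1) ≠ 0) :
    ratio η u * (qnum η 2 - ratio η (u + 1)) = 1 := by
  have h := qnum_add η 1 ((u : ℂ) + 1)
  have e : (1 : ℂ) + 1 = 2 := by norm_num
  have hq1 : qnum η 1 = 1 := by
    have hk : Complex.exp η - Complex.exp (-η) ≠ 0 := by
      intro hk
      simp [qnum, hk] at h0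
    simp only [qnum, mul_one]
    exact div_self hk
  rw [e, hq1, add_sub_cancel_right, add_comm (1 : ℂ)] at h
  simp only [ratio, Nat.cast_add, Nat.cast_one]
  rw [h]
  field_simp
  ring

/-! ### Families with the Hecke relations -/

/-- A family indexed by `ℤ` with the commutation and quadratic relations of the elements `a_i`;
the cubic relation holds for neighbours in the interval `[lo, hi]`. -/
structure IsHeckeFamily {R : Type*} [Ring R] [Algebra ℂ R] (c : ℂ) (A : ℤ → R) (lo hi : ℤ) :
    Prop where
  sq : ∀ x, A x * A x = c • A x
  comm : ∀ x y, x + 1 < y → Commute (A x) (A y)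
  braid : ∀ x, lo ≤ x → x + 1 ≤ hi →
    A x * A (x + 1) * A x - A x = A (x + 1) * A x * A (x + 1) - A (x + 1)

section

variable {R : Type*} [Ring R] [Algebra ℂ R] {c : ℂ} {A : ℤ → R} {lo hi : ℤ}

theorem IsHeckeFamily.neg (hA : IsHeckeFamily c A lo hi) :
    IsHeckeFamily c (fun x => A (-x)) (-hi) (-lo) where
  sq x := hA.sq _
  comm x y h := (hA.comm (-y) (-x) (by omega)).symm
  braid x h1 h2 := by
    have h := hA.braid (-x - 1) (by omega) (by omega)
    rw [sub_add_cancel] at h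
    have e : -(x + 1) = -x - 1 := by ring
    rw [e]
    exact h.symm

/-- The Baxterised element of parameter `u ≥ 1`; the parameter `0` stands for a missing factor. -/
def bax (w : ℕ → ℂ) (A : ℤ → R) (x : ℤ) (u : ℕ) : R :=
  if u = 0 then 1 else algebraMap ℂ R (w u) - A x

theorem bax_zero (w : ℕ → ℂ) (A : ℤ → R) (x : ℤ) : bax w A x 0 = 1 := by simp [bax]

theorem bax_pos (w : ℕ → ℂ) (A : ℤ → R) (x : ℤ) {u : ℕ} (hu : u ≠ 0) :
    bax w A x u = algebraMap ℂ R (w u) - A x := by simp [bax, hu]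

theorem IsHeckeFamily.commute_bax (hA : IsHeckeFamily c A lo hi) (w : ℕ → ℂ) {x y : ℤ}
    (h : x + 1 < y ∨ y + 1 < x) (u : ℕ) : Commute (A x) (bax w A y u) := by
  have h' : Commute (A x) (A y) := by
    rcases h with h | h
    · exact hA.comm x y h
    · exact (hA.comm y x h).symm
  unfold bax
  split_ifs
  · exact Commute.one_right _
  · exact (Algebra.commute_algebraMap_right _ _).sub_right h'

theorem IsHeckeFamily.bax_commute_bax (hA : IsHeckeFamily c A lo hi) (w : ℕ → ℂ) {x y : ℤ}
    (h : x + 1 < y ∨ y + 1 < x) (u v : ℕ) : Commute (bax w A x u) (bax w A y v) := by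
  have h' := hA.commute_bax w h v
  rw [bax.eq_def w A x]
  split_ifs
  · exact Commute.one_left _
  · exact (Algebra.commute_algebraMap_left _ _).sub_left h'

/-- The conditions on the weights `w u = [u + 1] / [u]` that make the Yang-Baxter equation hold up
to the parameter `K`. -/
structure IsBaxWeight (c : ℂ) (w : ℕ → ℂ) (K : ℕ) : Prop where
  one : w 1 = c
  mul : ∀ u, 1 ≤ u → u < K → w u * (c - w (u + 1)) = 1

variable {w : ℕ → ℂ} {K : ℕ}

theorem IsHeckeFamily.mul_bax_one (hA : IsHeckeFamily c A lo hi) (hw : IsBaxWeight c w K)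
    (x : ℤ) : A x * bax w A x 1 = 0 := by
  rw [bax_pos _ _ _ one_ne_zero, mul_sub, hA.sq, hw.one, Algebra.smul_def, Algebra.commutes,
    sub_self]

theorem IsHeckeFamily.bax_one_mul (hA : IsHeckeFamily c A lo hi) (hw : IsBaxWeight c w K)
    (x : ℤ) : bax w A x 1 * A x = 0 := by
  rw [bax_pos _ _ _ one_ne_zero, sub_mul, hA.sq, hw.one, Algebra.smul_def, sub_self]

/-- The case of the Yang-Baxter equation in which one of the parameters is `-1`, so that the
corresponding factor is `-a_i`. -/
theorem IsHeckeFamily.yangBaxter (hA : IsHeckeFamily c A lo hi) (hw : IsBaxWeight c w K) {x : ℤ}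
    (h1 : lo ≤ x) (h2 : x + 1 ≤ hi) {u : ℕ} (hu : 1 ≤ u) (hu' : u < K) :
    A (x + 1) * (bax w A x u * bax w A (x + 1) (u + 1)) =
      bax w A x (u + 1) * bax w A (x + 1) u * A x := by
  rw [bax_pos _ _ _ (by omega), bax_pos _ _ _ (by omega), bax_pos _ _ _ (by omega),
    bax_pos _ _ _ (by omega)]
  have hb := hA.braid x h1 h2
  have e := congrArg (algebraMap ℂ R) (hw.mul u hu hu')
  have s1 := hA.sq x
  have s2 := hA.sq (x + 1)
  rw [map_mul, map_sub, map_one] at e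
  rw [Algebra.smul_def] at s1 s2
  generalize hs : algebraMap ℂ R (w u) = s at *
  generalize ht : algebraMap ℂ R (w (u + 1)) = t at *
  generalize hcc : algebraMap ℂ R c = d at *
  have cs : ∀ r : R, r * s = s * r := fun r => by rw [← hs]; exact (Algebra.commutes _ r).symm
  have ct : ∀ r : R, r * t = t * r := fun r => by rw [← ht]; exact (Algebra.commutes _ r).symm
  generalize A x = a at *
  generalize A (x + 1) = b at *
  have L : b * ((s - a) * (t - b)) = s * t * b - s * (b * b) - t * (b * a) + b * a * b := by
    have : b * ((s - a) * (t - b)) = b * s * t - b * s * b - b * a * t + b * a * b := by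
      noncomm_ring
    rw [this, cs b, ct (b * a), mul_assoc s b t, ct b]
    noncomm_ring
  have M : (t - a) * (s - b) * a = s * t * a - s * (a * a) - t * (b * a) + a * b * a := by
    have : (t - a) * (s - b) * a = t * s * a - a * s * a - t * b * a + a * b * a := by
      noncomm_ring
    rw [this, cs a, cs t]
    noncomm_ring
  have k : ∀ r : R, s * t * r - s * (d * r) = -r := fun r => by
    have : s * t * r - s * (d * r) = -(s * (d - t) * r) := by noncomm_ring
    rw [this, e, one_mul]
  rw [L, M, s1, s2, k, k]
  have hb' : a * b * a = b * a * b - b + a := by rw [← hb]; abel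
  rw [hb']
  abel

/-! ### Rows of Baxterised elements and the Jones-Wenzl element -/

/-- The product `h_x(u) h_{x+1}(u+1) ⋯ h_{x+n-1}(u+n-1)`. -/
def row (w : ℕ → ℂ) (A : ℤ → R) : ℤ → ℕ → ℕ → R
  | _, _, 0 => 1
  | x, u, n + 1 => bax w A x u * row w A (x + 1) (u + 1) n

/-- The product `h_{x+n-1}(u+n-1) ⋯ h_{x+1}(u+1) h_x(u)`. -/
def rowRev (w : ℕ → ℂ) (A : ℤ → R) : ℤ → ℕ → ℕ → R
  | _, _, 0 => 1
  | x, u, n + 1 => rowRev w A (x + 1) (u + 1) n * bax w A x u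

theorem IsHeckeFamily.commute_row (hA : IsHeckeFamily c A lo hi) (n : ℕ) :
    ∀ (x j : ℤ) (u : ℕ), j + 1 < x → Commute (A j) (row w A x u n) := by
  induction n with
  | zero => intro x j u _; exact Commute.one_right _
  | succ n ih =>
    intro x j u h
    exact (hA.commute_bax w (Or.inl h) u).mul_right (ih _ _ _ (by omega))

/-- An element `a_j` moves through a row, from left to right, and its index drops by one. -/
theorem IsHeckeFamily.exists_mul_row (hA : IsHeckeFamily c A lo hi) (hw : IsBaxWeight c w K)
    (n : ℕ) : ∀ (x j : ℤ) (u : ℕ), lo ≤ x → x + n ≤ hi + 1 → 1 ≤ u → u + n ≤ K + 1 →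
      x < j → j < x + n → ∃ X, A j * row w A x u n = X * A (j - 1) := by
  induction n with
  | zero => intro x j u _ _ _ _ h1 h2; push_cast at h2; omega
  | succ n ih =>
    intro x j u hlo hhi hu hK h1 h2
    push_cast at hhi h2
    by_cases hj : j = x + 1
    · subst hj
      obtain ⟨k, rfl⟩ : ∃ k, n = k + 1 := ⟨n - 1, by omega⟩
      refine ⟨bax w A x (u + 1) * bax w A (x + 1) u * row w A (x + 1 + 1) (u + 1 + 1) k, ?_⟩
      have h3 := hA.commute_row (w := w) k (x + 1 + 1) x (u + 1 + 1) (by omega)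
      calc A (x + 1) * row w A x u (k + 1 + 1)
          = A (x + 1) * (bax w A x u * bax w A (x + 1) (u + 1)) *
              row w A (x + 1 + 1) (u + 1 + 1) k := by
            simp only [row, mul_assoc]
        _ = _ := by
            rw [hA.yangBaxter hw hlo (by omega) hu (by omega), add_sub_cancel_right,
              mul_assoc _ (A x), h3.eq, ← mul_assoc]
    · obtain ⟨X, hX⟩ := ih (x + 1) j (u + 1) (by omega) (by omega) (by omega) (by omega)
        (by omega) (by omega)
      refine ⟨bax w A x u * X, ?_⟩
      have h3 := hA.commute_bax w (x := j) (y := x) (Or.inr (by omega)) u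
      rw [row, ← mul_assoc, h3.eq, mul_assoc, hX, mul_assoc]

theorem IsHeckeFamily.commute_rowRev (hA : IsHeckeFamily c A lo hi) (n : ℕ) :
    ∀ (x j : ℤ) (u : ℕ), j + 1 < x → Commute (A j) (rowRev w A x u n) := by
  induction n with
  | zero => intro x j u _; exact Commute.one_right _
  | succ n ih =>
    intro x j u h
    exact (ih _ _ _ (by omega)).mul_right (hA.commute_bax w (Or.inl h) u)

/-- The Yang-Baxter equation of `IsHeckeFamily.yangBaxter`, read backwards. -/
theorem IsHeckeFamily.yangBaxter_rev (hA : IsHeckeFamily c A lo hi) (hw : IsBaxWeight c w K)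
    {x : ℤ} (h1 : lo ≤ x) (h2 : x + 1 ≤ hi) {u : ℕ} (hu : 1 ≤ u) (hu' : u < K) :
    bax w A (x + 1) (u + 1) * bax w A x u * A (x + 1) =
      A x * (bax w A (x + 1) u * bax w A x (u + 1)) := by
  have h := hA.neg.yangBaxter hw (x := -x - 1) (by omega) (by omega) hu hu'
  have e1 : -(-x - 1 + 1) = x := by ring
  have e2 : -(-x - 1) = x + 1 := by ring
  simp only [bax, e1, e2] at h ⊢
  exact h.symm

theorem IsHeckeFamily.exists_rowRev_mul (hA : IsHeckeFamily c A lo hi) (hw : IsBaxWeight c w K)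
    (n : ℕ) : ∀ (x j : ℤ) (u : ℕ), lo ≤ x → x + n ≤ hi + 1 → 1 ≤ u → u + n ≤ K + 1 →
      x < j → j < x + n → ∃ X, rowRev w A x u n * A j = A (j - 1) * X := by
  induction n with
  | zero => intro x j u _ _ _ _ h1 h2; push_cast at h2; omega
  | succ n ih =>
    intro x j u hlo hhi hu hK h1 h2
    push_cast at hhi h2
    by_cases hj : j = x + 1
    · subst hj
      obtain ⟨k, rfl⟩ : ∃ k, n = k + 1 := ⟨n - 1, by omega⟩
      refine ⟨rowRev w A (x + 1 + 1) (u + 1 + 1) k * (bax w A (x + 1) u * bax w A x (u + 1)), ?_⟩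
      have h3 := hA.commute_rowRev (w := w) k (x + 1 + 1) x (u + 1 + 1) (by omega)
      calc rowRev w A x u (k + 1 + 1) * A (x + 1)
          = rowRev w A (x + 1 + 1) (u + 1 + 1) k *
              (bax w A (x + 1) (u + 1) * bax w A x u * A (x + 1)) := by
            simp only [rowRev, mul_assoc]
        _ = _ := by
            rw [hA.yangBaxter_rev hw hlo (by omega) hu (by omega), add_sub_cancel_right,
              ← mul_assoc, ← h3.eq, mul_assoc]
    · obtain ⟨X, hX⟩ := ih (x + 1) j (u + 1) (by omega) (by omega) (by omega) (by omega)
        (by omega) (by omega)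
      refine ⟨X * bax w A x u, ?_⟩
      have h3 := hA.commute_bax w (x := j) (y := x) (Or.inr (by omega)) u
      rw [rowRev, mul_assoc, ← h3.eq, ← mul_assoc, hX, mul_assoc]

end

section

variable {V : Type*} [AddCommGroup V] [Module ℂ V] {c : ℂ} {A : ℤ → Module.End ℂ V} {lo hi : ℤ}
  {w : ℕ → ℂ} {K : ℕ}

theorem bax_apply_of_eq_zero {x : ℤ} {v : V} (hv : A x v = 0) {u : ℕ} (hu : u ≠ 0) :
    bax w A x u v = w u • v := by
  rw [bax_pos _ _ _ hu, LinearMap.sub_apply, hv, sub_zero, Module.algebraMap_end_apply]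

theorem rowRev_apply_of_eq_zero {v : V} (n : ℕ) : ∀ (x : ℤ) (u : ℕ), 1 ≤ u →
    (∀ k, u ≤ k → k < u + n → w k ≠ 0) → (∀ j, x ≤ j → j < x + n → A j v = 0) →
    rowRev w A x u n v = (∏ k ∈ Finset.range n, w (u + k)) • v := by
  induction n with
  | zero => intro x u _ _ _; simp [rowRev]
  | succ n ih =>
    intro x u hu hw hv
    rw [rowRev, Module.End.mul_apply, bax_apply_of_eq_zero (hv x le_rfl (by push_cast; omega))
      (by omega), map_smul, ih (x + 1) (u + 1) (by omega)
        (fun k h1 h2 => hw k (by omega) (by omega))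
      (fun j h1 h2 => hv j (by omega) (by push_cast; omega)), smul_smul, Finset.prod_range_succ']
    congr 1
    rw [mul_comm]
    congr 1
    exact Finset.prod_congr rfl fun k _ => by rw [add_assoc, add_comm 1 k]

/-- The Jones-Wenzl element of `n` neighbouring generators: it is annihilated by them, and it acts
as a non-zero scalar on the vectors that they annihilate. -/
theorem IsHeckeFamily.exists_jonesWenzl (hA : IsHeckeFamily c A lo hi) (hw : IsBaxWeight c w K)
    (hw0 : ∀ k, 1 ≤ k → k ≤ K → w k ≠ 0) {x : ℤ} (hx : lo ≤ x) (n : ℕ) (hn : x + n ≤ hi + 1)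
    (hK : n ≤ K) :
    ∃ (P : Module.End ℂ V) (κ : ℂ), κ ≠ 0 ∧ (∀ j, x ≤ j → j < x + n → P * A j = 0) ∧
      ∀ v, (∀ j, x ≤ j → j < x + n → A j v = 0) → P v = κ • v := by
  induction n with
  | zero => exact ⟨1, 1, one_ne_zero, fun j h1 h2 => by push_cast at h2; omega, fun v _ => by simp⟩
  | succ n ih =>
    push_cast at hn
    obtain ⟨P, κ, hκ, hP, hPv⟩ := ih (by omega) (by omega)
    refine ⟨P * rowRev w A x 1 (n + 1), (∏ k ∈ Finset.range (n + 1), w (1 + k)) * κ,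
      mul_ne_zero (Finset.prod_ne_zero_iff.2 fun k hk => ?_) hκ, fun j h1 h2 => ?_, fun v hv => ?_⟩
    · rw [Finset.mem_range] at hk
      exact hw0 _ (by omega) (by omega)
    · push_cast at h2
      rcases h1.eq_or_lt with rfl | h1
      · rw [rowRev, mul_assoc, mul_assoc, hA.bax_one_mul hw, mul_zero, mul_zero]
      · obtain ⟨X, hX⟩ := hA.exists_rowRev_mul hw (n + 1) x j 1 hx (by push_cast; omega) le_rfl
          (by omega) h1 (by push_cast; omega)
        rw [mul_assoc, hX, ← mul_assoc, hP _ (by omega) (by omega), zero_mul]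
    · push_cast at hv
      rw [Module.End.mul_apply, rowRev_apply_of_eq_zero (n + 1) x 1 le_rfl
        (fun k h1 h2 => hw0 k h1 (by omega)) (fun j h1 h2 => hv j h1 (by push_cast at h2; omega)),
        map_smul, hPv v (fun j h1 h2 => hv j h1 (by omega)), smul_smul]

end

/-! ### Products over lists of boxes -/

/-- Two lists with the same elements have the same product if in both of them every two elements
stand in an order that `P` allows, and elements for which both orders are allowed commute. -/
theorem prod_map_eq_of_perm {M ι : Type*} [Monoid M] (f : ι → M) (P : ι → ι → Prop) :
    ∀ {L L' : List ι}, L.Perm L' → L.Pairwise P → L'.Pairwise P →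
      (∀ s ∈ L, ∀ t ∈ L, P s t → P t s → Commute (f s) (f t)) →
      (L.map f).prod = (L'.map f).prod := by
  intro L
  induction L with
  | nil =>
    intro L' h _ _ _
    rw [List.nil_perm.1 h]
  | cons t L ih =>
    intro L' h h1 h2 h3
    obtain ⟨B, C, rfl⟩ := List.append_of_mem (h.subset List.mem_cons_self)
    have hp : L.Perm (B ++ C) := (List.perm_cons t).1 (h.trans List.perm_middle)
    rw [List.pairwise_cons] at h1
    have h4 : (B ++ C).Pairwise P := h2.sublist
      (List.Sublist.append_left (List.sublist_cons_self _ _) _)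
    have hc : Commute (f t) (B.map f).prod := by
      refine Commute.list_prod_right _ _ fun y hy => ?_
      obtain ⟨s, hs, rfl⟩ := List.mem_map.1 hy
      have hsL : s ∈ L := hp.symm.subset (List.mem_append_left _ hs)
      exact h3 _ List.mem_cons_self _ (List.mem_cons_of_mem _ hsL) (h1.1 s hsL)
        ((List.pairwise_append.1 h2).2.2 s hs t List.mem_cons_self)
    rw [List.map_cons, List.prod_cons, ih hp h1.2 h4
      (fun s hs u hu => h3 s (List.mem_cons_of_mem _ hs) u (List.mem_cons_of_mem _ hu)),
      List.map_append, List.map_append, List.prod_append, List.prod_append, List.map_cons,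
      List.prod_cons, ← mul_assoc, hc.eq, mul_assoc]

/-- The box `s` may stand to the left of the box `t` in a product: a box on top of another one,
in the same or in a neighbouring column, has to come later. -/
def BoxOrder (s t : ℤ × ℤ) : Prop := |s.1 - t.1| ≤ 1 → s.2 ≤ t.2

/-- The boxes `(x, y), (x + 1, y + 1), …`. -/
def rowBoxes : ℤ → ℤ → ℕ → List (ℤ × ℤ)
  | _, _, 0 => []
  | x, y, n + 1 => (x, y) :: rowBoxes (x + 1) (y + 1) n

/-- The boxes of a tilted rectangle with lowest box `(x, y)`, which has `l` rows of length `r`;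
the rows go to the upper right and follow one another to the upper left. -/
def rectBoxes : ℤ → ℤ → ℕ → ℕ → List (ℤ × ℤ)
  | _, _, 0, _ => []
  | x, y, l + 1, r => rowBoxes x y r ++ rectBoxes (x - 1) (y + 1) l r

/-- The reflection of the boxes that turns rows into columns. -/
def mirror (t : ℤ × ℤ) : ℤ × ℤ := (-t.1, t.2)

theorem mem_rowBoxes {n : ℕ} : ∀ {x y : ℤ} {t : ℤ × ℤ}, t ∈ rowBoxes x y n ↔
    x ≤ t.1 ∧ t.1 < x + n ∧ t.2 - y = t.1 - x := by
  induction n with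
  | zero => intro x y t; simp only [rowBoxes, List.not_mem_nil, false_iff]; push_cast; omega
  | succ n ih =>
    intro x y t
    rw [rowBoxes, List.mem_cons, ih, Prod.ext_iff]
    push_cast
    constructor
    · rintro (⟨h1, h2⟩ | h) <;> omega
    · intro h
      omega

theorem mem_rectBoxes {l : ℕ} : ∀ {x y : ℤ} {r : ℕ} {t : ℤ × ℤ}, t ∈ rectBoxes x y l r ↔
    ∃ a b : ℕ, a < l ∧ b < r ∧ t.1 = x + b - a ∧ t.2 = y + a + b := by
  induction l with
  | zero => intro x y r t; simp [rectBoxes]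
  | succ l ih =>
    intro x y r t
    rw [rectBoxes, List.mem_append, ih, mem_rowBoxes]
    constructor
    · rintro (h | ⟨a, b, h⟩)
      · exact ⟨0, (t.1 - x).toNat, by omega⟩
      · exact ⟨a + 1, b, by push_cast; omega⟩
    · rintro ⟨a, b, h1, h2, h3, h4⟩
      rcases Nat.eq_zero_or_pos a with rfl | ha
      · left; push_cast at *; omega
      · right; exact ⟨a - 1, b, by omega⟩

theorem rowBoxes_pairwise (n : ℕ) : ∀ x y : ℤ,
    (rowBoxes x y n).Pairwise fun s t => s.1 < t.1 ∧ s.2 < t.2 := by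
  induction n with
  | zero => intro x y; exact List.Pairwise.nil
  | succ n ih =>
    intro x y
    refine List.pairwise_cons.2 ⟨fun t ht => ?_, ih _ _⟩
    rw [mem_rowBoxes] at ht
    simp only
    omega

theorem rectBoxes_pairwise (l : ℕ) : ∀ (x y : ℤ) (r : ℕ),
    (rectBoxes x y l r).Pairwise fun s t => BoxOrder s t ∧ s ≠ t := by
  induction l with
  | zero => intro x y r; exact List.Pairwise.nil
  | succ l ih =>
    intro x y r
    refine List.pairwise_append.2 ⟨(rowBoxes_pairwise r x y).imp fun h => ?_, ih _ _ _,
      fun s hs t ht => ?_⟩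
    · exact ⟨fun _ => h.2.le, fun e => by rw [e] at h; omega⟩
    · rw [mem_rowBoxes] at hs
      obtain ⟨a, b, h1, h2, h3, h4⟩ := mem_rectBoxes.1 ht
      refine ⟨fun h => ?_, fun e => ?_⟩
      · rw [abs_le] at h; omega
      · rw [e] at hs; omega

theorem rectBoxes_nodup (x y : ℤ) (l r : ℕ) : (rectBoxes x y l r).Nodup :=
  (rectBoxes_pairwise l x y r).imp fun h => h.2

theorem rectBoxes_boxOrder (x y : ℤ) (l r : ℕ) : (rectBoxes x y l r).Pairwise BoxOrder :=
  (rectBoxes_pairwise l x y r).imp fun h => h.1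

theorem mirror_mirror (t : ℤ × ℤ) : mirror (mirror t) = t := by simp [mirror]

theorem rectBoxes_mirror_perm (x y : ℤ) (l r : ℕ) :
    (rectBoxes x y l r).Perm ((rectBoxes (-x) y r l).map mirror) := by
  refine (List.perm_ext_iff_of_nodup (rectBoxes_nodup _ _ _ _)
    ((rectBoxes_nodup _ _ _ _).map (Function.LeftInverse.injective mirror_mirror))).2 fun t => ?_
  rw [mem_rectBoxes, List.mem_map]
  constructor
  · rintro ⟨a, b, h⟩
    refine ⟨mirror t, mem_rectBoxes.2 ⟨b, a, ?_⟩, mirror_mirror t⟩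
    simp only [mirror]
    omega
  · rintro ⟨s, hs, rfl⟩
    obtain ⟨a, b, h⟩ := mem_rectBoxes.1 hs
    refine ⟨b, a, ?_⟩
    simp only [mirror]
    omega

theorem prod_rowBoxes {M : Type*} [CommMonoid M] (f : ℤ × ℤ → M) (n : ℕ) : ∀ x y : ℤ,
    ((rowBoxes x y n).map f).prod = ∏ b ∈ Finset.range n, f (x + b, y + b) := by
  induction n with
  | zero => intro x y; simp [rowBoxes]
  | succ n ih =>
    intro x y
    rw [rowBoxes, List.map_cons, List.prod_cons, ih, Finset.prod_range_succ', mul_comm]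
    congr 1
    · refine Finset.prod_congr rfl fun b _ => ?_
      push_cast
      congr 2 <;> ring
    · simp

theorem prod_rectBoxes {M : Type*} [CommMonoid M] (f : ℤ × ℤ → M) (l : ℕ) : ∀ (x y : ℤ) (r : ℕ),
    ((rectBoxes x y l r).map f).prod =
      ∏ a ∈ Finset.range l, ∏ b ∈ Finset.range r, f (x + b - a, y + a + b) := by
  induction l with
  | zero => intro x y r; simp [rectBoxes]
  | succ l ih =>
    intro x y r
    rw [rectBoxes, List.map_append, List.prod_append, ih, prod_rowBoxes, Finset.prod_range_succ',
      mul_comm]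
    congr 1
    · refine Finset.prod_congr rfl fun a _ => Finset.prod_congr rfl fun b _ => ?_
      push_cast
      congr 2 <;> ring
    · simp

section

variable {R : Type*} [Ring R] [Algebra ℂ R] {c : ℂ} {A : ℤ → R} {lo hi : ℤ}
  {w : ℕ → ℂ} {K : ℕ}

/-- The product of the Baxterised elements of a list of boxes; the parameter of a box is its height
above `h`. -/
def boxProd (w : ℕ → ℂ) (A : ℤ → R) (h : ℤ) (L : List (ℤ × ℤ)) : R :=
  (L.map fun t => bax w A t.1 (t.2 - h).toNat).prod

theorem boxProd_rowBoxes (h : ℤ) (n : ℕ) : ∀ (x : ℤ) (u : ℕ),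
    boxProd w A h (rowBoxes x (h + u) n) = row w A x u n := by
  induction n with
  | zero => intro x u; simp [rowBoxes, boxProd, row]
  | succ n ih =>
    intro x u
    have e := ih (x + 1) (u + 1)
    push_cast at e
    rw [← add_assoc] at e
    rw [row, ← e]
    simp [rowBoxes, boxProd]

theorem IsHeckeFamily.boxProd_perm (hA : IsHeckeFamily c A lo hi) (h : ℤ) {L L' : List (ℤ × ℤ)}
    (hp : L.Perm L') (h1 : L.Pairwise BoxOrder) (h2 : L'.Pairwise BoxOrder)
    (hL : ∀ s ∈ L, ∀ t ∈ L, |s.1 - t.1| ≤ 1 → s.2 = t.2 → s = t) :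
    boxProd w A h L = boxProd w A h L' := by
  refine prod_map_eq_of_perm _ BoxOrder hp h1 h2 fun s hs t ht hst hts => ?_
  by_cases hd : |s.1 - t.1| ≤ 1
  · have := hL s hs t ht hd (le_antisymm (hst hd) (hts (by rwa [abs_sub_comm])))
    rw [this]
    exact Commute.refl _
  · refine hA.bax_commute_bax w ?_ _ _
    rw [abs_le] at hd
    omega

theorem IsHeckeFamily.exists_mul_rectBoxes (hA : IsHeckeFamily c A lo hi)
    (hw : IsBaxWeight c w K) (h : ℤ) (r : ℕ) (l : ℕ) : ∀ (x j : ℤ) (u : ℕ), lo + l ≤ x + 1 →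
      x + r ≤ hi + 1 → 1 ≤ u → u + l + r ≤ K + 2 → x < j → j < x + r →
      ∃ X, A j * boxProd w A h (rectBoxes x (h + u) l r) = X * A (j - l) := by
  induction l with
  | zero => intro x j u _ _ _ _ _ _; exact ⟨1, by simp [rectBoxes, boxProd]⟩
  | succ l ih =>
    intro x j u h1 h2 h3 h4 h5 h6
    push_cast at h1
    obtain ⟨X, hX⟩ := hA.exists_mul_row hw r x j u (by omega) h2 h3 (by omega) h5 h6
    obtain ⟨Y, hY⟩ := ih (x - 1) (j - 1) (u + 1) (by omega) (by omega) (by omega) (by omega)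
      (by omega) (by omega)
    refine ⟨X * Y, ?_⟩
    have e : boxProd w A h (rectBoxes x (h + u) (l + 1) r) =
        row w A x u r * boxProd w A h (rectBoxes (x - 1) (h + (u + 1 : ℕ)) l r) := by
      rw [← boxProd_rowBoxes h]
      simp only [boxProd, rectBoxes, List.map_append, List.prod_append]
      push_cast
      rw [← add_assoc]
    rw [e, ← mul_assoc, hX, mul_assoc, hY, ← mul_assoc]
    congr 2
    push_cast
    ring

theorem IsHeckeFamily.mul_rectBoxes_self (hA : IsHeckeFamily c A lo hi)
    (hw : IsBaxWeight c w K) (h i : ℤ) {l r : ℕ} (hl : 1 ≤ l) (hr : 1 ≤ r) :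
    A i * boxProd w A h (rectBoxes i (h + 1) l r) = 0 := by
  obtain ⟨l, rfl⟩ : ∃ k, l = k + 1 := ⟨l - 1, by omega⟩
  obtain ⟨r, rfl⟩ : ∃ k, r = k + 1 := ⟨r - 1, by omega⟩
  have e : (h + 1 - h).toNat = 1 := by omega
  rw [boxProd, rectBoxes, rowBoxes, List.cons_append, List.map_cons, List.prod_cons, e,
    ← mul_assoc, hA.mul_bax_one hw, zero_mul]

theorem IsHeckeFamily.boxProd_rectBoxes_mirror (hA : IsHeckeFamily c A lo hi) (h x y : ℤ)
    (l r : ℕ) : boxProd w A h (rectBoxes x y l r) =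
      boxProd w (fun x => A (-x)) h (rectBoxes (-x) y r l) := by
  rw [hA.boxProd_perm h (rectBoxes_mirror_perm x y l r) (rectBoxes_boxOrder _ _ _ _)]
  · simp only [boxProd, List.map_map]
    rfl
  · refine List.pairwise_map.2 ((rectBoxes_boxOrder _ _ _ _).imp fun {s t} hst hd => hst ?_)
    simp only [mirror] at hd
    rw [abs_le] at hd ⊢
    omega
  · intro s hs t ht hd he
    obtain ⟨a, b, h1⟩ := mem_rectBoxes.1 hs
    obtain ⟨a', b', h2⟩ := mem_rectBoxes.1 ht
    rw [abs_le] at hd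
    rw [Prod.ext_iff]
    omega

end

/-- Fusion: if `v` is annihilated by the generators of the interval `(i - l, i + r)` other than the
one at the top of the rectangle, then the product over the rectangle maps `v` to a vector that is
annihilated by all of them. -/
theorem IsHeckeFamily.apply_rectBoxes_eq_zero {V : Type*} [AddCommGroup V] [Module ℂ V] {c : ℂ}
    {A : ℤ → Module.End ℂ V} {lo hi : ℤ} {w : ℕ → ℂ} {K : ℕ}
    (hA : IsHeckeFamily c A lo hi) (hw : IsBaxWeight c w K)
    (h i : ℤ) {l r : ℕ} (hl : 1 ≤ l) (hr : 1 ≤ r) (hlo : lo + l ≤ i + 1) (hhi : i + r ≤ hi + 1)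
    (hK : l + r ≤ K + 1) {v : V}
    (hv : ∀ k, i - l < k → k < i + r → k ≠ i + r - l → A k v = 0) {j : ℤ}
    (hj1 : i - l < j) (hj2 : j < i + r) :
    A j (boxProd w A h (rectBoxes i (h + 1) l r) v) = 0 := by
  rw [← Module.End.mul_apply]
  rcases lt_trichotomy j i with hlt | rfl | hgt
  · obtain ⟨X, hX⟩ := hA.neg.exists_mul_rectBoxes hw h l r (-i) (-j) 1 (by omega) (by omega) le_rfl
      (by omega) (by omega) (by omega)
    have e : -(-j - (r : ℤ)) = j + r := by ring
    rw [neg_neg, Nat.cast_one, e] at hX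
    rw [hA.boxProd_rectBoxes_mirror, hX, Module.End.mul_apply,
      hv _ (by omega) (by omega) (by omega), map_zero]
  · rw [hA.mul_rectBoxes_self hw h j hl hr, LinearMap.zero_apply]
  · obtain ⟨X, hX⟩ := hA.exists_mul_rectBoxes hw h r l i j 1 hlo hhi le_rfl (by omega) hgt hj2
    rw [Nat.cast_one] at hX
    rw [hX, Module.End.mul_apply, hv _ (by omega) (by omega) (by omega), map_zero]

/-! ### Paths as functions on `ℤ` -/

/-- The heights of a path, extended to `ℤ` by a slope `+1` to the left of `0` and a slope `-1` to
the right of `N`; there are no local minima outside the path, and no boundary cases. -/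
def hz {N : ℕ} (α : DyckPath N) (x : ℤ) : ℤ :=
  if x < 0 then x
  else if h : x < N + 1 then α.height ⟨x.toNat, by omega⟩
  else ((N % 2 : ℕ) : ℤ) - (x - N)

section

variable {N : ℕ}

theorem hz_fin (α : DyckPath N) (k : Fin (N + 1)) : hz α (k : ℕ) = α.height k := by
  have h1 : ¬ (((k : ℕ) : ℤ) < 0) := by omega
  have h2 : ((k : ℕ) : ℤ) < N + 1 := by omega
  simp [hz, h1, h2]

theorem hz_of_nonpos (α : DyckPath N) {x : ℤ} (hx : x ≤ 0) : hz α x = x := by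
  rcases hx.lt_or_eq with h | rfl
  · simp [hz, h]
  · have := hz_fin α 0
    rw [α.start] at this
    exact this

theorem hz_of_ge (α : DyckPath N) {x : ℤ} (hx : (N : ℤ) ≤ x) :
    hz α x = ((N % 2 : ℕ) : ℤ) - (x - N) := by
  rcases hx.lt_or_eq with h | rfl
  · have h1 : ¬ (x < 0) := by omega
    have h2 : ¬ (x < N + 1) := by omega
    simp [hz, h1, h2]
  · have := hz_fin α (Fin.last N)
    rw [α.finish] at this
    simpa using this

theorem hz_nonneg (α : DyckPath N) {x : ℤ} (h0 : 0 ≤ x) (h1 : x ≤ N) : 0 ≤ hz α x := by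
  obtain ⟨k, rfl⟩ := Int.eq_ofNat_of_zero_le h0
  have := hz_fin α ⟨k, by omega⟩
  rw [this]
  exact α.nonneg _

theorem hz_step (α : DyckPath N) (x : ℤ) :
    hz α (x + 1) = hz α x + 1 ∨ hz α (x + 1) = hz α x - 1 := by
  rcases lt_or_ge x 0 with h0 | h0
  · rw [hz_of_nonpos α (show x + 1 ≤ 0 by omega), hz_of_nonpos α h0.le]
    omega
  rcases lt_or_ge x N with h1 | h1
  · obtain ⟨k, rfl⟩ := Int.eq_ofNat_of_zero_le h0
    have h := α.step ⟨k, by omega⟩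
    have e1 := hz_fin α (Fin.succ ⟨k, by omega⟩ : Fin (N + 1))
    have e2 := hz_fin α (Fin.castSucc ⟨k, by omega⟩ : Fin (N + 1))
    rw [← e1, ← e2] at h
    simpa using h
  · rw [hz_of_ge α h1, hz_of_ge α (show (N : ℤ) ≤ x + 1 by omega)]
    omega

theorem hz_injective : Function.Injective (hz : DyckPath N → ℤ → ℤ) := by
  intro α β h
  ext k
  rw [← hz_fin, ← hz_fin, h]

theorem hz_maxPath (x : ℤ) :
    hz (maxPath N) x = min x (2 * (((N + 1) / 2 : ℕ) : ℤ) - x) := by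
  rcases lt_or_ge x 0 with h0 | h0
  · rw [hz_of_nonpos _ h0.le]
    omega
  rcases lt_or_ge x N with h1 | h1
  · obtain ⟨k, rfl⟩ := Int.eq_ofNat_of_zero_le h0
    exact hz_fin (maxPath N) ⟨k, by omega⟩
  · rw [hz_of_ge _ h1]
    omega

theorem hz_le (α : DyckPath N) (k : ℕ) :
    ∀ x, hz α (x + k) ≤ hz α x + k ∧ hz α x - k ≤ hz α (x + k) := by
  induction k with
  | zero => intro x; simp
  | succ k ih =>
    intro x
    have h1 := ih x
    have h2 := hz_step α (x + k)
    push_cast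
    rw [← add_assoc]
    omega

theorem hz_lipschitz (α : DyckPath N) {x y : ℤ} (h : x ≤ y) :
    hz α y ≤ hz α x + (y - x) ∧ hz α x - (y - x) ≤ hz α y := by
  obtain ⟨k, rfl⟩ := Int.le.dest h
  have := hz_le α k x
  omega

theorem hz_le_maxPath (α : DyckPath N) (x : ℤ) : hz α x ≤ hz (maxPath N) x := by
  rw [hz_maxPath]
  rcases lt_or_ge x 0 with h0 | h0
  · rw [hz_of_nonpos _ h0.le]
    omega
  rcases lt_or_ge x N with h1 | h1
  · have e1 := hz_lipschitz α h0
    have e2 := hz_lipschitz α h1.le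
    rw [hz_of_nonpos _ le_rfl] at e1
    rw [hz_of_ge _ le_rfl] at e2
    omega
  · rw [hz_of_ge _ h1]
    omega

theorem hz_parity (α : DyckPath N) {x y : ℤ} (h : x ≤ y) : Even (hz α y - hz α x - (y - x)) := by
  obtain ⟨k, rfl⟩ := Int.le.dest h
  rw [Int.even_iff]
  clear h
  induction k with
  | zero => simp
  | succ k ih =>
    have := hz_step α (x + k)
    push_cast
    rw [← add_assoc]
    omega

theorem hz_parity_zero (α : DyckPath N) (x : ℤ) : Even (hz α x - x) := by
  have h0 := hz_of_nonpos α le_rfl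
  rcases le_total 0 x with h | h
  · have := hz_parity α h
    rw [Int.even_iff] at *
    omega
  · rw [hz_of_nonpos α h]
    simp

/-- The path with the heights given by a function on `ℤ`. -/
def ofFun (f : ℤ → ℤ) (h0 : f 0 = 0) (hN : f N = ((N % 2 : ℕ) : ℤ))
    (hnn : ∀ x : ℤ, 0 ≤ x → x ≤ N → 0 ≤ f x)
    (hs : ∀ x, f (x + 1) = f x + 1 ∨ f (x + 1) = f x - 1) : DyckPath N where
  height k := f (k : ℕ)
  start := by simpa using h0
  finish := by simpa using hN
  nonneg k := hnn _ (by omega) (by omega)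
  step k := by simpa using hs (k : ℕ)

theorem hz_ofFun {f : ℤ → ℤ} {h0 hN hnn hs} {x : ℤ} (hx0 : 0 ≤ x) (hx1 : x ≤ N) :
    hz (ofFun (N := N) f h0 hN hnn hs) x = f x := by
  obtain ⟨k, rfl⟩ := Int.eq_ofNat_of_zero_le hx0
  exact hz_fin _ ⟨k, by omega⟩

/-! ### The arms of a highest local minimum -/

/-- `x` is a local minimum of `f`. -/
def IsMinAt (f : ℤ → ℤ) (x : ℤ) : Prop := f (x - 1) = f x + 1 ∧ f (x + 1) = f x + 1

/-- `f` goes up from `i`, where its value is `h`, for exactly `r ≥ 1` steps, then down for at least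
`r` steps. -/
structure IsArm (f : ℤ → ℤ) (i h : ℤ) (r : ℕ) : Prop where
  pos : 1 ≤ r
  up : ∀ x, i ≤ x → x ≤ i + r → f x = h + (x - i)
  down : ∀ x, i + r ≤ x → x ≤ i + 2 * r → f x = h + 2 * r - (x - i)

theorem exists_isArm {f : ℤ → ℤ} (hs : ∀ x, f (x + 1) = f x + 1 ∨ f (x + 1) = f x - 1)
    (hB : ∃ B, ∀ x, B ≤ x → f (x + 1) = f x - 1) {i : ℤ} (hi : IsMinAt f i)
    (hmax : ∀ x, IsMinAt f x → f x ≤ f i) : ∃ r, IsArm f i (f i) r := by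
  have hex : ∃ k : ℕ, f (i + k + 1) ≠ f (i + k) + 1 := by
    obtain ⟨B, hB⟩ := hB
    refine ⟨(B - i).toNat, ?_⟩
    have := hB (i + (B - i).toNat) (by omega)
    omega
  classical
  have hr := Nat.find_spec hex
  have hlt : ∀ k, k < Nat.find hex → f (i + k + 1) = f (i + k) + 1 :=
    fun k hk => not_not.1 (Nat.find_min hex hk)
  generalize Nat.find hex = r at hr hlt
  have hup : ∀ k : ℕ, k ≤ r → f (i + k) = f i + k := by
    intro k
    induction k with
    | zero => intro _; simp
    | succ k ih =>
      intro hk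
      have h1 := ih (by omega)
      have h2 := hlt k (by omega)
      push_cast
      rw [← add_assoc]
      omega
  have hpos : 1 ≤ r := by
    rcases Nat.eq_zero_or_pos r with rfl | h
    · have := hi.2
      simp only [Nat.cast_zero, add_zero] at hr
      exact absurd this hr
    · exact h
  have hdown : ∀ k : ℕ, k ≤ r → f (i + r + k) = f i + r - k ∧
      (1 ≤ k → f (i + r + k - 1) = f (i + r + k) + 1) := by
    intro k
    induction k with
    | zero => intro _; have := hup r le_rfl; simp [this]
    | succ k ih =>
      intro hk
      obtain ⟨h1, h2⟩ := ih (by omega)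
      have h3 := hs (i + r + k)
      have h4 : f (i + r + k + 1) = f (i + r + k) - 1 := by
        rcases h3 with h3 | h3
        · exfalso
          rcases Nat.eq_zero_or_pos k with rfl | hk0
          · simp only [Nat.cast_zero, add_zero] at h3
            exact hr h3
          · have := hmax _ ⟨h2 hk0, h3⟩
            omega
        · exact h3
      push_cast
      rw [← add_assoc, add_sub_cancel_right]
      omega
  refine ⟨r, hpos, fun x h1 h2 => ?_, fun x h1 h2 => ?_⟩
  · have := hup (x - i).toNat (by omega)
    have e : i + ((x - i).toNat : ℤ) = x := by omega
    rw [e] at this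
    omega
  · have := (hdown (x - i - r).toNat (by omega)).1
    have e : i + r + ((x - i - r).toNat : ℤ) = x := by omega
    rw [e] at this
    omega

theorem isMinAt_mem {α : DyckPath N} {x : ℤ} (hx : IsMinAt (hz α) x) : 1 ≤ x ∧ x < N := by
  constructor
  · by_contra hc
    have h1 := hz_of_nonpos α (show x ≤ 0 by omega)
    have h2 := hz_of_nonpos α (show x - 1 ≤ 0 by omega)
    have h3 := hx.1
    omega
  · by_contra hc
    have h1 := hz_of_ge α (show (N : ℤ) ≤ x by omega)
    have h2 := hz_of_ge α (show (N : ℤ) ≤ x + 1 by omega)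
    have h3 := hx.2
    omega

theorem exists_isMinAt {α : DyckPath N} (hα : α ≠ maxPath N) : ∃ x, IsMinAt (hz α) x := by
  have hex : ∃ x, hz α x < hz (maxPath N) x := by
    by_contra hc
    push Not at hc
    exact hα (hz_injective (funext fun x => le_antisymm (hz_le_maxPath α x) (hc x)))
  have hmem : ∀ x, hz α x < hz (maxPath N) x → 0 ≤ x ∧ x ≤ N := by
    intro x hx
    constructor
    · by_contra hc
      rw [hz_of_nonpos α (by omega), hz_of_nonpos _ (by omega)] at hx
      omega
    · by_contra hc
      rw [hz_of_ge α (by omega), hz_of_ge _ (by omega)] at hx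
      omega
  -- A lowest point of the path among those strictly below the maximal path.
  have hlow : ∃ x, hz α x < hz (maxPath N) x ∧
      ∀ y, hz α y < hz (maxPath N) y → hz α x ≤ hz α y := by
    classical
    obtain ⟨x, hx, hmin⟩ := ((Finset.Icc (0 : ℤ) N).filter
      fun x => hz α x < hz (maxPath N) x).exists_min_image (hz α) (by
        obtain ⟨x, hx⟩ := hex
        exact ⟨x, Finset.mem_filter.2 ⟨Finset.mem_Icc.2 (hmem x hx), hx⟩⟩)
    refine ⟨x, (Finset.mem_filter.1 hx).2, fun y hy => hmin y ?_⟩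
    exact Finset.mem_filter.2 ⟨Finset.mem_Icc.2 (hmem y hy), hy⟩
  obtain ⟨x, hx, hmin⟩ := hlow
  refine ⟨x, ?_, ?_⟩
  · have h1 := hz_step α (x - 1)
    have h2 := hz_step (maxPath N) (x - 1)
    have h3 := hmin (x - 1)
    rw [sub_add_cancel] at h1 h2
    omega
  · have h1 := hz_step α x
    have h2 := hz_step (maxPath N) x
    have h3 := hmin (x + 1)
    omega

/-- A path other than the maximal one has a local minimum with an arm on both sides, namely any
highest one: turning upwards again too early would give a higher one. -/
theorem exists_arms {α : DyckPath N} (hα : α ≠ maxPath N) : ∃ (i : ℤ) (l r : ℕ),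
    IsArm (hz α) i (hz α i) r ∧ IsArm (fun x => hz α (-x)) (-i) (hz α i) l := by
  classical
  obtain ⟨i, hi, hmax⟩ := ((Finset.Icc (0 : ℤ) N).filter
    fun x => IsMinAt (hz α) x).exists_max_image (hz α) (by
      obtain ⟨x, hx⟩ := exists_isMinAt hα
      have := isMinAt_mem hx
      exact ⟨x, Finset.mem_filter.2 ⟨Finset.mem_Icc.2 (by omega), hx⟩⟩)
  rw [Finset.mem_filter] at hi
  have hmax' : ∀ x, IsMinAt (hz α) x → hz α x ≤ hz α i := fun x hx => by
    have := isMinAt_mem hx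
    exact hmax x (Finset.mem_filter.2 ⟨Finset.mem_Icc.2 (by omega), hx⟩)
  obtain ⟨r, hr⟩ := exists_isArm (hz_step α) ⟨N, fun x hx => by
    rw [hz_of_ge α hx, hz_of_ge α (by omega)]; ring⟩ hi.2 hmax'
  obtain ⟨l, hl⟩ := exists_isArm (f := fun x => hz α (-x)) (i := -i) (fun x => by
      have := hz_step α (-x - 1)
      rw [sub_add_cancel] at this
      have e : -(x + 1) = -x - 1 := by ring
      rw [e]
      omega)
    ⟨0, fun x hx => by
      rw [hz_of_nonpos α (by omega), hz_of_nonpos α (by omega)]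
      ring⟩ (by
      have e1 : -(-i - 1) = i + 1 := by ring
      have e2 : -(-i + 1) = i - 1 := by ring
      simp only [IsMinAt, e1, e2, neg_neg]
      exact hi.2.symm) (fun x hx => by
      have e1 : -(x - 1) = -x + 1 := by ring
      have e2 : -(x + 1) = -x - 1 := by ring
      simp only [IsMinAt, e1, e2] at hx
      simpa using hmax' (-x) hx.symm)
  rw [neg_neg] at hl
  exact ⟨i, l, r, hr, hl⟩

end

/-! ### Filling the rectangle above a local minimum -/

/-- The path `γ` arises from `α` by filling the `l × r` rectangle spanned by the arms of the local
minimum of `α` at `i`, of height `h`. -/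
structure IsFilling {N : ℕ} (α γ : DyckPath N) (i h : ℤ) (l r : ℕ) : Prop where
  right : IsArm (hz α) i h r
  left : IsArm (fun x => hz α (-x)) (-i) h l
  inside : ∀ x, i - l ≤ x → x ≤ i + r → hz γ x = h + l + r - |x - (i + r - l)|
  outside : ∀ x, x ≤ i - l ∨ i + r ≤ x → hz γ x = hz α x

section

variable {N : ℕ} {α γ δ : DyckPath N} {i h : ℤ} {l r : ℕ}

theorem IsArm.left_up (hL : IsArm (fun x => hz α (-x)) (-i) h l) {x : ℤ} (h1 : i - l ≤ x)
    (h2 : x ≤ i) : hz α x = h + (i - x) := by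
  have := hL.up (-x) (by omega) (by omega)
  simp only [neg_neg] at this
  omega

theorem IsArm.left_down (hL : IsArm (fun x => hz α (-x)) (-i) h l) {x : ℤ} (h1 : i - 2 * l ≤ x)
    (h2 : x ≤ i - l) : hz α x = h + 2 * l - (i - x) := by
  have := hL.down (-x) (by omega) (by omega)
  simp only [neg_neg] at this
  omega

theorem arms_bounds (hR : IsArm (hz α) i h r) (hL : IsArm (fun x => hz α (-x)) (-i) h l) :
    0 ≤ h ∧ 1 ≤ i - l ∧ i + r ≤ N := by
  have hr := hR.pos
  have hl := hL.pos
  have c1 := hR.up i le_rfl (by omega)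
  have c2 := hR.up (i + r) (by omega) le_rfl
  have c3 := hL.left_up (x := i - l) le_rfl (by omega)
  have hi0 : 0 ≤ i := by
    by_contra hc
    have h1 := hz_of_nonpos α (show i ≤ 0 by omega)
    have h2 := hz_of_nonpos α (show i - l ≤ 0 by omega)
    omega
  have hi1 : i ≤ N := by
    by_contra hc
    have h1 := hz_of_ge α (show (N : ℤ) ≤ i by omega)
    have h2 := hz_of_ge α (show (N : ℤ) ≤ i + r by omega)
    omega
  have h0 := hz_nonneg α hi0 hi1
  refine ⟨by omega, ?_, ?_⟩
  · by_contra hc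
    have h1 := hz_of_nonpos α (show i - l ≤ 0 by omega)
    omega
  · by_contra hc
    have h1 := hz_of_ge α (show (N : ℤ) ≤ i + r by omega)
    omega

theorem exists_isFilling (hR : IsArm (hz α) i h r) (hL : IsArm (fun x => hz α (-x)) (-i) h l) :
    ∃ γ, IsFilling α γ i h l r := by
  obtain ⟨b0, b1, b2⟩ := arms_bounds hR hL
  have hr := hR.pos
  have hl := hL.pos
  have hout : ∀ x, x ≤ i - l ∨ i + r ≤ x → h + l + r - |x - (i + r - l)| ≤ hz α x := by
    rintro x (hx | hx)
    · rw [abs_of_nonpos (by omega)]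
      rcases le_total (i - 2 * l) x with h1 | h1
      · have := hL.left_down h1 hx
        omega
      · have e1 := hL.left_down (x := i - 2 * l) le_rfl (by omega)
        have e2 := hz_lipschitz α h1
        omega
    · rw [abs_of_nonneg (by omega)]
      rcases le_total x (i + 2 * r) with h1 | h1
      · have := hR.down x hx h1
        omega
      · have e1 := hR.down (i + 2 * r) (by omega) le_rfl
        have e2 := hz_lipschitz α h1
        omega
  have hin : ∀ x, i - l ≤ x → x ≤ i + r → hz α x ≤ h + l + r - |x - (i + r - l)| := by
    intro x h1 h2
    rcases le_total x i with h3 | h3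
    · have := hL.left_up h1 h3
      rcases abs_cases (x - (i + r - l)) with h4 | h4 <;> omega
    · have := hR.up x h3 h2
      rcases abs_cases (x - (i + r - l)) with h4 | h4 <;> omega
  refine ⟨ofFun (fun x => max (hz α x) (h + l + r - |x - (i + r - l)|)) ?_ ?_ ?_ ?_, hR, hL,
    fun x h1 h2 => ?_, fun x hx => ?_⟩
  · rw [max_eq_left (hout 0 (by omega)), hz_of_nonpos α le_rfl]
  · rw [max_eq_left (hout N (by omega)), hz_of_ge α le_rfl]
    ring
  · intro x h0 h1
    exact le_max_of_le_left (hz_nonneg α h0 h1)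
  · intro x
    have h1 := hz_step α x
    have p1 := hz_parity_zero α x
    have p2 := hz_parity_zero α i
    have p3 := hR.up i le_rfl (by omega)
    rw [Int.even_iff] at p1 p2
    rcases abs_cases (x - (i + r - l)) with h4 | h4 <;>
      rcases abs_cases (x + 1 - (i + r - l)) with h5 | h5 <;>
      rcases max_cases (hz α x) (h + l + r - |x - (i + r - l)|) with h6 | h6 <;>
      rcases max_cases (hz α (x + 1)) (h + l + r - |x + 1 - (i + r - l)|) with h7 | h7 <;>
      omega
  · rw [hz_ofFun (by omega) (by omega)]
    exact max_eq_right (hin x h1 h2)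
  · rcases lt_or_ge x 0 with h0 | h0
    · rw [hz_of_nonpos _ h0.le, hz_of_nonpos _ h0.le]
    rcases lt_or_ge (N : ℤ) x with h1 | h1
    · rw [hz_of_ge _ h1.le, hz_of_ge _ h1.le]
    rw [hz_ofFun h0 h1]
    exact max_eq_left (hout x hx)

theorem IsFilling.le (hF : IsFilling α γ i h l r) (x : ℤ) : hz α x ≤ hz γ x := by
  by_cases hx : x ≤ i - l ∨ i + r ≤ x
  · exact (hF.outside x hx).ge
  push Not at hx
  rw [hF.inside x (by omega) (by omega)]
  rcases le_total x i with h3 | h3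
  · have := hF.left.left_up (x := x) (by omega) h3
    rcases abs_cases (x - (i + r - l)) with h4 | h4 <;> omega
  · have := hF.right.up x h3 (by omega)
    rcases abs_cases (x - (i + r - l)) with h4 | h4 <;> omega

/-! ### Tiles and contents on `ℤ × ℤ` -/

/-- There is a tile centred at `t` between the path and the maximal path. -/
def TileAt (α : DyckPath N) (t : ℤ × ℤ) : Prop :=
  Odd (t.1 + t.2) ∧ hz α t.1 < t.2 ∧ t.2 < hz (maxPath N) t.1

theorem TileAt.mono (h : ∀ x, hz α x ≤ hz δ x) {t : ℤ × ℤ} (ht : TileAt δ t) : TileAt α t :=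
  ⟨ht.1, (h _).trans_lt ht.2.1, ht.2.2⟩

theorem TileAt.bounds {t : ℤ × ℤ} (ht : TileAt α t) : 1 ≤ t.1 ∧ t.1 < N ∧ 1 ≤ t.2 := by
  have h1 := ht.2.1.trans ht.2.2
  have hx : 0 ≤ t.1 ∧ t.1 < N := by
    constructor
    · by_contra hc
      rw [hz_of_nonpos _ (by omega), hz_of_nonpos _ (by omega)] at h1
      exact lt_irrefl _ h1
    · by_contra hc
      rw [hz_of_ge _ (by omega), hz_of_ge _ (by omega)] at h1
      exact lt_irrefl _ h1
  have h2 := hz_nonneg α hx.1 hx.2.le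
  refine ⟨?_, hx.2, by have := ht.2.1; omega⟩
  rcases hx.1.eq_or_lt with h | h
  · rw [← h, hz_of_nonpos _ le_rfl, hz_of_nonpos _ le_rfl] at h1
    omega
  · omega

/-- The tiles between `α` and `γ` are the boxes of the rectangle. -/
theorem IsFilling.mem_rectBoxes_iff (hF : IsFilling α γ i h l r) (t : ℤ × ℤ) :
    t ∈ rectBoxes i (h + 1) l r ↔ TileAt α t ∧ ¬ TileAt γ t := by
  have hr := hF.right.pos
  have hl := hF.left.pos
  have p2 := hz_parity_zero α i
  have p3 := hF.right.up i le_rfl (by omega)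
  rw [Int.even_iff] at p2
  rw [mem_rectBoxes]
  constructor
  · rintro ⟨a, b, ha, hb, h1, h2⟩
    have hγ := hF.inside t.1 (by omega) (by omega)
    have hlt : t.2 < hz γ t.1 := by
      rcases abs_cases (t.1 - (i + r - l)) with h4 | h4 <;> omega
    refine ⟨⟨?_, ?_, hlt.trans_le (hz_le_maxPath _ _)⟩, fun hc => absurd hc.2.1 (by omega)⟩
    · rw [Int.odd_iff]
      omega
    · rcases le_total t.1 i with h3 | h3
      · have := hF.left.left_up (x := t.1) (by omega) h3
        omega
      · have := hF.right.up t.1 h3 (by omega)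
        omega
  · rintro ⟨hα, hγ⟩
    have hle : t.2 ≤ hz γ t.1 := by
      by_contra hc
      exact hγ ⟨hα.1, by omega, hα.2.2⟩
    have hx : ¬ (t.1 ≤ i - l ∨ i + r ≤ t.1) := fun hx => by
      have := hF.outside _ hx
      have := hα.2.1
      omega
    push Not at hx
    have e1 := hF.inside t.1 (by omega) (by omega)
    have e2 := hα.2.1
    have e3 := hα.1
    rw [Int.odd_iff] at e3
    refine ⟨((t.2 - h - 1 - (t.1 - i)) / 2).toNat, ((t.2 - h - 1 + (t.1 - i)) / 2).toNat, ?_⟩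
    rcases le_total t.1 i with h3 | h3
    · have := hF.left.left_up (x := t.1) (by omega) h3
      rcases abs_cases (t.1 - (i + r - l)) with h4 | h4 <;> omega
    · have := hF.right.up t.1 h3 (by omega)
      rcases abs_cases (t.1 - (i + r - l)) with h4 | h4 <;> omega

end

section

variable {m : ℕ} {α γ δ : DyckPath (m + 1)} {i h : ℤ} {l r : ℕ}

/-- The content of the tile centred at `t`; it is `0` if there is no tile. -/
def contentAt (α : DyckPath (m + 1)) (t : ℤ × ℤ) : ℕ :=
  if hx : 1 ≤ t.1 ∧ t.1 ≤ m then content α t.2.toNat ⟨(t.1 - 1).toNat, by omega⟩ else 0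

theorem contentAt_fin (α : DyckPath (m + 1)) (k : Fin m) (j : ℕ) :
    contentAt α ((k : ℤ) + 1, (j : ℤ)) = content α j k := by
  have h1 : (1 : ℤ) ≤ (k : ℕ) + 1 ∧ ((k : ℕ) : ℤ) + 1 ≤ m := by omega
  simp [contentAt, h1]

theorem isTile_iff (α : DyckPath (m + 1)) (k : Fin m) (j : ℕ) :
    IsTile α k j ↔ TileAt α ((k : ℤ) + 1, (j : ℤ)) := by
  have e : ∀ β : DyckPath (m + 1), hz β ((k : ℤ) + 1) = β.height (pos k) := fun β => by
    rw [← hz_fin]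
    simp [pos]
  unfold IsTile TileAt
  rw [e, e, Int.odd_iff, Nat.even_iff]
  constructor
  · rintro ⟨h1, h2, h3⟩
    exact ⟨by simp only; omega, h2, h3⟩
  · rintro ⟨h1, h2, h3⟩
    exact ⟨by simp only at h1; omega, h2, h3⟩

open Classical in
theorem contentAt_eq (α : DyckPath (m + 1)) (x y : ℤ) : contentAt α (x, y) =
    if TileAt α (x, y) then
      max (contentAt α (x - 1, y - 1)) (contentAt α (x + 1, y - 1)) + 1 else 0 := by
  by_cases hx : 1 ≤ x ∧ x ≤ m
  swap
  · have : ¬ TileAt α (x, y) := fun ht => by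
      have := ht.bounds
      simp only at this
      omega
    rw [if_neg this, contentAt, dif_neg hx]
  obtain ⟨k, rfl⟩ : ∃ k : Fin m, (k : ℤ) + 1 = x :=
    ⟨⟨(x - 1).toNat, by omega⟩, by simp only; omega⟩
  by_cases hy : 1 ≤ y
  swap
  · have : ¬ TileAt α ((k : ℤ) + 1, y) := fun ht => by
      have := ht.bounds
      simp only at this
      omega
    rw [if_neg this, contentAt, dif_pos hx]
    have e : y.toNat = 0 := by omega
    simp only [e, content]
  obtain ⟨j, rfl⟩ : ∃ j : ℕ, (j : ℤ) + 1 = y := ⟨(y - 1).toNat, by omega⟩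
  have e : ((j : ℤ) + 1) = ((j + 1 : ℕ) : ℤ) := by push_cast; ring
  rw [e, contentAt_fin, content]
  simp only [isTile_iff]
  split_ifs with ht
  · congr 1
    have e2 : ((j + 1 : ℕ) : ℤ) - 1 = j := by push_cast; ring
    rw [e2, add_sub_cancel_right]
    apply le_antisymm
    · refine Finset.sup_le fun k' hk' => ?_
      rw [← contentAt_fin]
      rcases (Finset.mem_filter.1 hk').2 with h1 | h1
      · refine le_max_of_le_right (le_of_eq ?_)
        congr 2
        omega
      · refine le_max_of_le_left (le_of_eq ?_)
        congr 2
        omega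
    · refine max_le ?_ ?_
      · by_cases hk : 1 ≤ (k : ℕ)
        · have hmem : (⟨(k : ℕ) - 1, by omega⟩ : Fin m) ∈ Finset.univ.filter fun k' : Fin m =>
              (k' : ℕ) = (k : ℕ) + 1 ∨ (k : ℕ) = (k' : ℕ) + 1 :=
            Finset.mem_filter.2 ⟨Finset.mem_univ _, Or.inr (by simp only; omega)⟩
          have := Finset.le_sup (f := fun k => content α j k) hmem
          refine le_trans (le_of_eq ?_) this
          rw [← contentAt_fin]
          congr 2
          simp only
          omega
        · rw [contentAt, dif_neg (by simp only; omega)]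
          exact Nat.zero_le _
      · by_cases hk : (k : ℕ) + 1 < m
        · have hmem : (⟨(k : ℕ) + 1, hk⟩ : Fin m) ∈ Finset.univ.filter fun k' : Fin m =>
              (k' : ℕ) = (k : ℕ) + 1 ∨ (k : ℕ) = (k' : ℕ) + 1 :=
            Finset.mem_filter.2 ⟨Finset.mem_univ _, Or.inl rfl⟩
          have := Finset.le_sup (f := fun k => content α j k) hmem
          refine le_trans (le_of_eq ?_) this
          rw [← contentAt_fin]
          congr 2
        · rw [contentAt, dif_neg (by simp only; omega)]
          exact Nat.zero_le _
  · rfl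

theorem contentAt_of_not_tileAt {t : ℤ × ℤ} (ht : ¬ TileAt α t) : contentAt α t = 0 := by
  rw [contentAt_eq α t.1 t.2, if_neg ht]

theorem contentAt_of_tileAt {x y : ℤ} (ht : TileAt α (x, y)) : contentAt α (x, y) =
    max (contentAt α (x - 1, y - 1)) (contentAt α (x + 1, y - 1)) + 1 := by
  rw [contentAt_eq α x y, if_pos ht]

/-- The tiles along a slope form a chain. -/
theorem lt_contentAt_of_slope {s : ℤ} (hs : s = 1 ∨ s = -1) (k : ℕ) : ∀ {x y : ℤ},
    TileAt γ (x, y) → y = hz γ x + 1 → (∀ z : ℕ, z ≤ k → hz γ (x + s * z) = hz γ x - z) →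
    k < contentAt γ (x, y) := by
  induction k with
  | zero =>
    intro x y ht _ _
    rw [contentAt_of_tileAt ht]
    omega
  | succ k ih =>
    intro x y ht hy hslope
    have h1 := hslope 1 (by omega)
    rw [Nat.cast_one, mul_one] at h1
    have hΩ : hz (maxPath (m + 1)) x - 1 ≤ hz (maxPath (m + 1)) (x + s) := by
      rcases hs with rfl | rfl
      · have := hz_lipschitz (maxPath (m + 1)) (show x ≤ x + 1 by omega)
        omega
      · have := hz_lipschitz (maxPath (m + 1)) (show x + -1 ≤ x by omega)
        omega
    have ht' : TileAt γ (x + s, y - 1) := by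
      obtain ⟨p1, p2, p3⟩ := ht
      simp only at p1 p2 p3
      rw [Int.odd_iff] at p1
      refine ⟨?_, ?_, ?_⟩ <;> simp only
      · rw [Int.odd_iff]
        omega
      · omega
      · omega
    have h2 := ih ht' (by omega) fun z hz' => by
      have := hslope (z + 1) (by omega)
      push_cast at this
      rw [h1, add_assoc]
      rw [mul_add, mul_one, add_comm (s * (z : ℤ))] at this
      omega
    rw [contentAt_of_tileAt ht]
    rcases hs with rfl | rfl
    · have := le_max_right (contentAt γ (x - 1, y - 1)) (contentAt γ (x + 1, y - 1))
      omega
    · have := le_max_left (contentAt γ (x - 1, y - 1)) (contentAt γ (x + 1, y - 1))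
      rw [← sub_eq_add_neg] at h2
      omega

/-- The contents in the rectangle of a path `δ` between `α` and `γ` are determined by their
recursion inside the rectangle. -/
theorem IsFilling.contentAt_rect (hF : IsFilling α γ i h l r) (hδ : ∀ x, hz α x ≤ hz δ x)
    {G : ℕ → ℕ → ℕ} (hG0 : ∀ a b, a < l → b < r → h + 1 + a + b ≤ hz δ (i + b - a) → G a b = 0)
    (hG : ∀ a b, a < l → b < r → hz δ (i + b - a) < h + 1 + a + b →
      G a b = max (if b = 0 then 0 else G a (b - 1)) (if a = 0 then 0 else G (a - 1) b) + 1)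
    (n : ℕ) : ∀ a b, a + b = n → a < l → b < r →
      contentAt δ (i + b - a, h + 1 + a + b) = G a b := by
  induction n using Nat.strong_induction_on with
  | _ n ih =>
    intro a b hn ha hb
    have hmem := (hF.mem_rectBoxes_iff (i + b - a, h + 1 + a + b)).1
      (mem_rectBoxes.2 ⟨a, b, ha, hb, rfl, rfl⟩)
    by_cases ht : hz δ (i + b - a) < h + 1 + a + b
    swap
    · rw [hG0 a b ha hb (by omega)]
      exact contentAt_of_not_tileAt fun hc => ht hc.2.1
    rw [hG a b ha hb ht, contentAt_of_tileAt ⟨hmem.1.1, ht, hmem.1.2.2⟩]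
    congr 2
    · rcases Nat.eq_zero_or_pos b with rfl | hb0
      · rw [if_pos rfl]
        refine contentAt_of_not_tileAt fun hc => ?_
        have h1 := hc.2.1
        have h2 := hδ (i + (0 : ℕ) - a - 1)
        have h3 := hF.left.left_up (x := i + (0 : ℕ) - a - 1) (by omega) (by omega)
        simp only at h1
        omega
      · rw [if_neg (by omega), ← ih (a + (b - 1)) (by omega) a (b - 1) rfl ha (by omega)]
        congr 2 <;> omega
    · rcases Nat.eq_zero_or_pos a with rfl | ha0
      · rw [if_pos rfl]
        refine contentAt_of_not_tileAt fun hc => ?_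
        have h1 := hc.2.1
        have h2 := hδ (i + b - (0 : ℕ) + 1)
        have h3 := hF.right.up (i + b - (0 : ℕ) + 1) (by omega) (by omega)
        simp only at h1
        omega
      · rw [if_neg (by omega), ← ih (a - 1 + b) (by omega) (a - 1) b rfl (by omega) hb]
        congr 2 <;> omega

/-- Inside the rectangle, contents are at most the height above the local minimum. -/
theorem IsFilling.contentAt_le (hF : IsFilling α γ i h l r) (hδ : ∀ x, hz α x ≤ hz δ x) (n : ℕ) :
    ∀ a b, a + b = n → a < l → b < r → contentAt δ (i + b - a, h + 1 + a + b) ≤ a + b + 1 := by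
  induction n using Nat.strong_induction_on with
  | _ n ih =>
    intro a b hn ha hb
    by_cases ht : TileAt δ (i + b - a, h + 1 + a + b)
    swap
    · rw [contentAt_of_not_tileAt ht]
      omega
    rw [contentAt_of_tileAt ht]
    refine Nat.succ_le_succ (max_le ?_ ?_)
    · rcases Nat.eq_zero_or_pos b with rfl | hb0
      · rw [contentAt_of_not_tileAt fun hc => ?_]
        · omega
        have h1 := hc.2.1
        have h2 := hδ (i + (0 : ℕ) - a - 1)
        have h3 := hF.left.left_up (x := i + (0 : ℕ) - a - 1) (by omega) (by omega)
        simp only at h1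
        omega
      · have := ih (a + (b - 1)) (by omega) a (b - 1) rfl ha (by omega)
        refine le_trans (le_of_eq ?_) (this.trans (by omega))
        congr 2 <;> omega
    · rcases Nat.eq_zero_or_pos a with rfl | ha0
      · rw [contentAt_of_not_tileAt fun hc => ?_]
        · omega
        have h1 := hc.2.1
        have h2 := hδ (i + b - (0 : ℕ) + 1)
        have h3 := hF.right.up (i + b - (0 : ℕ) + 1) (by omega) (by omega)
        simp only at h1
        omega
      · have := ih (a - 1 + b) (by omega) (a - 1) b rfl (by omega) hb
        refine le_trans (le_of_eq ?_) (this.trans (by omega))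
        congr 2 <;> omega

/-- Outside the rectangle the contents are those of `γ`: a chain that ends in the rectangle is no
longer than the one along the slope next to the rectangle. -/
theorem IsFilling.contentAt_outside (hF : IsFilling α γ i h l r) (h1 : ∀ x, hz α x ≤ hz δ x)
    (h2 : ∀ x, hz δ x ≤ hz γ x) (n : ℕ) :
    ∀ x y : ℤ, y.toNat = n → TileAt γ (x, y) → contentAt δ (x, y) = contentAt γ (x, y) := by
  have hr := hF.right.pos
  have hl := hF.left.pos
  induction n using Nat.strong_induction_on with
  | _ n ih =>
    intro x y hn ht
    have hb := ht.bounds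
    simp only at hb
    have hle : ∀ x', contentAt γ (x', y - 1) ≤ contentAt δ (x', y - 1) := fun x' => by
      by_cases htc : TileAt γ (x', y - 1)
      · exact (ih _ (by omega) x' (y - 1) rfl htc).ge
      · rw [contentAt_of_not_tileAt htc]
        exact Nat.zero_le _
    have key : ∀ s : ℤ, s = 1 ∨ s = -1 → contentAt δ (x + s, y - 1) ≤
        max (contentAt γ (x - 1, y - 1)) (contentAt γ (x + 1, y - 1)) := by
      intro s hs
      by_cases htc : TileAt γ (x + s, y - 1)
      · rw [ih _ (by omega) (x + s) (y - 1) rfl htc]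
        rcases hs with rfl | rfl
        · exact le_max_right _ _
        · exact le_max_left _ _
      by_cases htd : TileAt δ (x + s, y - 1)
      swap
      · rw [contentAt_of_not_tileAt htd]
        exact Nat.zero_le _
      obtain ⟨a, b, ha, hb, e1, e2⟩ := mem_rectBoxes.1
        ((hF.mem_rectBoxes_iff _).2 ⟨htd.mono h1, htc⟩)
      simp only at e1 e2
      have hcl : contentAt δ (x + s, y - 1) ≤ a + b + 1 := by
        rw [e1, e2]
        exact hF.contentAt_le h1 _ a b rfl ha hb
      have g1 := hF.inside (x + s) (by omega) (by omega)
      have g2 := ht.2.1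
      have p := hz_parity_zero γ x
      have p' := ht.1
      simp only at g2 p'
      rw [Int.even_iff] at p
      rw [Int.odd_iff] at p'
      refine hcl.trans ?_
      have hΩ := ht.2.2
      simp only at hΩ
      rcases hs with rfl | rfl
      · -- The box of the rectangle is to the lower right: go down along the left slope.
        refine le_max_of_le_left ?_
        have g0 := hF.inside x (by omega) (by omega)
        have hal : a + 1 = l := by
          rcases abs_cases (x + 1 - (i + r - l)) with h4 | h4 <;>
            rcases abs_cases (x - (i + r - l)) with h5 | h5 <;> omega
        have hslope : ∀ z, i - 2 * l ≤ z → z ≤ x → hz γ z = h + 2 * l - (i - z) := by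
          intro z hz1 hz2
          rcases le_total z (i - l) with hz3 | hz3
          · rw [hF.outside z (Or.inl hz3)]
            exact hF.left.left_down hz1 hz3
          · rw [hF.inside z hz3 (by omega), abs_of_nonpos (by omega)]
            omega
        have hΩ' := hz_lipschitz (maxPath (m + 1)) (show x - 1 ≤ x by omega)
        have s1 := hslope (x - 1) (by omega) (by omega)
        have := lt_contentAt_of_slope (γ := γ) (s := -1) (Or.inr rfl) (a + b) (x := x - 1)
          (y := y - 1) ⟨by simp only; rw [Int.odd_iff]; omega, by simp only; omega,
            by simp only; omega⟩ (by omega) (fun z hz' => by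
            rw [hslope (x - 1 + -1 * z) (by omega) (by omega), s1]
            ring)
        omega
      · refine le_max_of_le_right ?_
        have g0 := hF.inside x (by omega) (by omega)
        have hal : b + 1 = r := by
          rcases abs_cases (x + -1 - (i + r - l)) with h4 | h4 <;>
            rcases abs_cases (x - (i + r - l)) with h5 | h5 <;> omega
        have hslope : ∀ z, x ≤ z → z ≤ i + 2 * r → hz γ z = h + 2 * r - (z - i) := by
          intro z hz1 hz2
          rcases le_total (i + r) z with hz3 | hz3
          · rw [hF.outside z (Or.inr hz3)]
            exact hF.right.down z hz3 hz2
          · rw [hF.inside z (by omega) hz3, abs_of_nonneg (by omega)]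
            omega
        have hΩ' := hz_lipschitz (maxPath (m + 1)) (show x ≤ x + 1 by omega)
        have s1 := hslope (x + 1) (by omega) (by omega)
        have := lt_contentAt_of_slope (γ := γ) (s := 1) (Or.inl rfl) (a + b) (x := x + 1)
          (y := y - 1) ⟨by simp only; rw [Int.odd_iff]; omega, by simp only; omega,
            by simp only; omega⟩ (by omega) (fun z hz' => by
            rw [hslope (x + 1 + 1 * z) (by omega) (by omega), s1]
            ring)
        omega
    rw [contentAt_of_tileAt ht, contentAt_of_tileAt (ht.mono h2)]
    congr 1
    refine le_antisymm (max_le ?_ (key 1 (Or.inl rfl))) (max_le_max (hle _) (hle _))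
    exact key (-1) (Or.inr rfl)

end

/-! ### The generators on paths, in terms of the extended heights -/

section

variable {m : ℕ} {α β γ : DyckPath (m + 1)} {i h : ℤ} {l r : ℕ}

theorem hz_pos (α : DyckPath (m + 1)) (k : Fin m) : α.height (pos k) = hz α ((k : ℤ) + 1) := by
  rw [← hz_fin]
  simp [pos]

theorem isLocMin_iff (k : Fin m) : IsLocMin α k ↔ IsMinAt (hz α) ((k : ℤ) + 1) := by
  have h1 := hz_fin α k.castSucc.castSucc
  have h2 := hz_fin α k.succ.succ
  simp only [Fin.val_castSucc, Fin.val_succ] at h1 h2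
  push_cast at h2
  rw [IsLocMin, IsMinAt, hz_pos, ← h1, ← h2, add_sub_cancel_right]

/-- `x` is a local maximum of `f`. -/
def IsMaxAt (f : ℤ → ℤ) (x : ℤ) : Prop := f (x - 1) = f x - 1 ∧ f (x + 1) = f x - 1

theorem isLocMax_iff (k : Fin m) : IsLocMax α k ↔ IsMaxAt (hz α) ((k : ℤ) + 1) := by
  have h1 := hz_fin α k.castSucc.castSucc
  have h2 := hz_fin α k.succ.succ
  simp only [Fin.val_castSucc, Fin.val_succ] at h1 h2
  push_cast at h2
  rw [IsLocMax, IsMaxAt, hz_pos, ← h1, ← h2, add_sub_cancel_right]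

theorem hz_eq_of_forall {N : ℕ} (α : DyckPath N) (f : ℤ → ℤ)
    (h0 : ∀ x, x < 0 ∨ (N : ℤ) < x → f x = hz α x)
    (h : ∀ k : Fin (N + 1), α.height k = f (k : ℕ)) : hz α = f := by
  funext x
  by_cases hx : x < 0 ∨ (N : ℤ) < x
  · exact (h0 x hx).symm
  push Not at hx
  obtain ⟨k, rfl⟩ := Int.eq_ofNat_of_zero_le hx.1
  have := hz_fin α ⟨k, by omega⟩
  rw [this, h]

theorem hz_raise (k : Fin m) (hmin : IsLocMin α k) (x : ℤ) :
    hz (raise α k hmin) x = if x = (k : ℤ) + 1 then hz α x + 2 else hz α x := by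
  refine congrFun (hz_eq_of_forall _ (fun x => if x = (k : ℤ) + 1 then hz α x + 2 else hz α x)
    (fun x hx => ?_) fun l => ?_) x
  · rw [if_neg (by push_cast at hx; omega)]
    rcases hx with hx | hx
    · rw [hz_of_nonpos _ hx.le, hz_of_nonpos _ hx.le]
    · rw [hz_of_ge _ hx.le, hz_of_ge _ hx.le]
  · simp only [raise, hz_fin]
    refine if_congr ?_ rfl rfl
    simp only [pos, Fin.ext_iff, Fin.val_castSucc, Fin.val_succ]
    omega

/-- `x` belongs to the excursion of `f` above the height at `i`, to the right of `i`. -/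
def RightExc (f : ℤ → ℤ) (i x : ℤ) : Prop := i < x ∧ ∀ z, i < z → z ≤ x → f i < f z

open Classical in
theorem hz_peel (k : Fin m) (hk : 1 ≤ α.height (pos k)) (x : ℤ) :
    hz (peel α k hk) x = if RightExc (hz α) ((k : ℤ) + 1) x ∨
      RightExc (fun z => hz α (-z)) (-((k : ℤ) + 1)) (-x) then hz α x - 2 else hz α x := by
  refine congrFun (hz_eq_of_forall _ (fun x => if RightExc (hz α) ((k : ℤ) + 1) x ∨
      RightExc (fun z => hz α (-z)) (-((k : ℤ) + 1)) (-x) then hz α x - 2 else hz α x)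
    (fun x hx => ?_) fun l => ?_) x
  · rw [hz_pos] at hk
    rw [if_neg]
    · rcases hx with hx | hx
      · rw [hz_of_nonpos _ hx.le, hz_of_nonpos _ hx.le]
      · rw [hz_of_ge _ hx.le, hz_of_ge _ hx.le]
    · rintro (h1 | h1)
      · have := h1.2 x h1.1 le_rfl
        rcases hx with hx | hx
        · rw [hz_of_nonpos α hx.le] at this
          omega
        · rw [hz_of_ge α hx.le] at this
          omega
      · have := h1.2 (-x) h1.1 le_rfl
        simp only [neg_neg] at this
        rcases hx with hx | hx
        · rw [hz_of_nonpos α hx.le] at this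
          omega
        · rw [hz_of_ge α hx.le] at this
          omega
  · simp only [peel, hz_fin]
    refine if_congr ?_ rfl rfl
    have hp : ((pos k : Fin (m + 2)) : ℕ) = (k : ℕ) + 1 := by simp [pos]
    constructor
    · rintro ⟨h1, h2⟩
      rw [ne_eq, Fin.ext_iff, hp] at h1
      have key : ∀ z : ℤ, z ≠ (k : ℤ) + 1 → ((k : ℤ) + 1 ≤ z ∧ z ≤ (l : ℕ) ∨
          ((l : ℕ) : ℤ) ≤ z ∧ z ≤ (k : ℤ) + 1) → hz α ((k : ℤ) + 1) < hz α z := by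
        intro z hz1 hz2
        obtain ⟨j, rfl⟩ := Int.eq_ofNat_of_zero_le (show 0 ≤ z by omega)
        have := h2 ⟨j, by omega⟩ (by
          rw [Set.mem_uIcc]
          simp only [Fin.le_def, hp]
          omega) (by
          rw [ne_eq, Fin.ext_iff, hp]
          simp only
          omega)
        rw [hz_pos, ← hz_fin] at this
        exact this
      rcases lt_or_gt_of_ne h1 with h3 | h3
      · refine Or.inr ⟨by omega, fun z hz1 hz2 => ?_⟩
        simp only [neg_neg]
        exact key (-z) (by omega) (by omega)
      · exact Or.inl ⟨by omega, fun z hz1 hz2 => key z (by omega) (by omega)⟩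
    · rintro (⟨h1, h2⟩ | ⟨h1, h2⟩)
      · refine ⟨?_, fun t ht hne => ?_⟩
        · rw [ne_eq, Fin.ext_iff, hp]
          omega
        · rw [Set.mem_uIcc] at ht
          simp only [Fin.le_def, hp] at ht
          rw [ne_eq, Fin.ext_iff, hp] at hne
          rw [hz_pos, ← hz_fin]
          exact h2 _ (by omega) (by omega)
      · refine ⟨?_, fun t ht hne => ?_⟩
        · rw [ne_eq, Fin.ext_iff, hp]
          omega
        · rw [Set.mem_uIcc] at ht
          simp only [Fin.le_def, hp] at ht
          rw [ne_eq, Fin.ext_iff, hp] at hne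
          rw [hz_pos, ← hz_fin]
          have := h2 (-(t : ℕ)) (by omega) (by omega)
          simpa using this

theorem not_rightExc_self (f : ℤ → ℤ) (x : ℤ) : ¬ RightExc f x x := fun hE => lt_irrefl _ hE.1

theorem not_rightExc_of_le {f : ℤ → ℤ} {x : ℤ} (hf : f (x + 1) ≤ f x) (y : ℤ) : ¬ RightExc f x y :=
  fun hE => absurd (hE.2 (x + 1) (by omega) (by have := hE.1; omega)) (by omega)

theorem not_rightExc_of_lt {f : ℤ → ℤ} {x y : ℤ} (h : y ≤ x) : ¬ RightExc f x y :=
  fun hE => absurd hE.1 (by omega)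

theorem rightExc_succ {f : ℤ → ℤ} {x : ℤ} (hf : f x < f (x + 1)) : RightExc f x (x + 1) :=
  ⟨by omega, fun z h1 h2 => by
    have : z = x + 1 := by omega
    rw [this]
    exact hf⟩

theorem slope_cases (α : DyckPath (m + 1)) {x : ℤ} (h1 : ¬ IsMinAt (hz α) x)
    (h2 : ¬ IsMaxAt (hz α) x) :
    (hz α (x - 1) = hz α x - 1 ∧ hz α (x + 1) = hz α x + 1) ∨
      (hz α (x - 1) = hz α x + 1 ∧ hz α (x + 1) = hz α x - 1) := by
  have e1 := hz_step α (x - 1)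
  have e2 := hz_step α x
  rw [sub_add_cancel] at e1
  unfold IsMinAt at h1
  unfold IsMaxAt at h2
  omega

/-- On an uphill slope, only the excursion to the right is lowered. -/
theorem hz_peel_of_up (k : Fin m) (hk : 1 ≤ α.height (pos k))
    (h1 : hz α ((k : ℤ) + 1 - 1) = hz α ((k : ℤ) + 1) - 1) (x : ℤ)
    [Decidable (RightExc (hz α) ((k : ℤ) + 1) x)] :
    hz (peel α k hk) x = if RightExc (hz α) ((k : ℤ) + 1) x then hz α x - 2 else hz α x := by
  have h2 : ¬ RightExc (fun z => hz α (-z)) (-((k : ℤ) + 1)) (-x) := by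
    refine not_rightExc_of_le ?_ _
    have e : -(-((k : ℤ) + 1) + 1) = (k : ℤ) + 1 - 1 := by ring
    simp only [e, neg_neg]
    omega
  rw [hz_peel]
  simp only [h2, or_false]

/-- On a downhill slope, only the excursion to the left is lowered. -/
theorem hz_peel_of_down (k : Fin m) (hk : 1 ≤ α.height (pos k))
    (h1 : hz α ((k : ℤ) + 1 + 1) = hz α ((k : ℤ) + 1) - 1) (x : ℤ)
    [Decidable (RightExc (fun z => hz α (-z)) (-((k : ℤ) + 1)) (-x))] :
    hz (peel α k hk) x = if RightExc (fun z => hz α (-z)) (-((k : ℤ) + 1)) (-x) then hz α x - 2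
      else hz α x := by
  have h2 : ¬ RightExc (hz α) ((k : ℤ) + 1) x := not_rightExc_of_le (by omega) _
  rw [hz_peel]
  simp only [h2, false_or]

theorem isMaxAt_peel (k : Fin m) (hk : 1 ≤ α.height (pos k)) (h1 : ¬ IsLocMin α k)
    (h2 : ¬ IsLocMax α k) : IsLocMax (peel α k hk) k := by
  classical
  rw [isLocMin_iff] at h1
  rw [isLocMax_iff] at h2 ⊢
  generalize hx : (k : ℤ) + 1 = x at *
  rcases slope_cases α h1 h2 with ⟨h3, h4⟩ | ⟨h3, h4⟩
  · have e := hz_peel_of_up k hk (by rw [hx]; exact h3)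
    rw [hx] at e
    unfold IsMaxAt
    rw [e, e, e, if_neg (not_rightExc_self _ _), if_neg (not_rightExc_of_lt (by omega)),
      if_pos (rightExc_succ (by omega))]
    omega
  · have e := hz_peel_of_down k hk (by rw [hx]; exact h4)
    rw [hx] at e
    have e1 : -(x - 1) = -x + 1 := by ring
    unfold IsMaxAt
    rw [e, e, e, if_neg (not_rightExc_self _ _),
      if_neg (not_rightExc_of_lt (by omega : -(x + 1) ≤ -x)), e1, if_pos (rightExc_succ (by
        have e2 : -(-x + 1) = x - 1 := by ring
        simp only [e2, neg_neg]
        omega))]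
    omega

theorem isMaxAt_raise (k : Fin m) (h1 : IsLocMin α k) : IsLocMax (raise α k h1) k := by
  have h1' := (isLocMin_iff k).1 h1
  rw [isLocMax_iff]
  unfold IsMinAt at h1'
  unfold IsMaxAt
  rw [hz_raise, hz_raise, hz_raise, if_neg (by omega), if_pos rfl, if_neg (by omega)]
  omega

/-- The image of `e_k` is spanned by the paths with a local maximum at the position of `k`. -/
theorem tlGen_apply_of_not_isLocMax (η : ℂ) (k : Fin m) (hβ : ¬ IsLocMax β k) (v : States m) :
    tlGen η k v β = 0 := by
  suffices h : (Finsupp.lapply β : States m →ₗ[ℂ] ℂ) ∘ₗ tlGen η k = 0 from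
    congrArg (fun L : States m →ₗ[ℂ] ℂ => L v) h
  refine Finsupp.lhom_ext' fun α => LinearMap.ext_ring ?_
  simp only [LinearMap.comp_apply, Finsupp.lsingle_apply, tlGen, Finsupp.linearCombination_single,
    one_smul, Finsupp.lapply_apply, LinearMap.zero_apply, tlOnPath]
  split_ifs with h1 h2
  · exact Finsupp.single_eq_of_ne' fun e => hβ (e ▸ isMaxAt_raise k h1)
  · exact Finsupp.single_eq_of_ne' fun e => hβ (e ▸ h2)
  · exact Finsupp.single_eq_of_ne' fun e => hβ (e ▸ isMaxAt_peel k _ h1 h2)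

/-- The heights `f`, raised by two at the points `x` and `y`. -/
def bump (f : ℤ → ℤ) (x y : ℤ) (z : ℤ) : ℤ := if z = x ∨ z = y then f z + 2 else f z

/-- The only excursion whose lowering gives the path with a tile on the local minimum at `i`
is the one that consists of the next point of the arm: a longer one would have to follow the whole
arm of `g`, two units above it, down to a point that is not above the height at `i`. -/
theorem eq_bump_of_lower {f g : ℤ → ℤ} (hf : ∀ x, f (x + 1) = f x + 1 ∨ f (x + 1) = f x - 1)
    (hg : IsArm g i h r) (hup : f (i + 1) = f i + 1)
    (h1 : ∀ x, RightExc f i x → f x = bump g i i x + 2)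
    (h2 : ∀ x, ¬ RightExc f i x → f x = bump g i i x) : f = bump g i (i + 1) := by
  have hr := hg.pos
  have hi : f i = h + 2 := by
    rw [h2 i (not_rightExc_self _ _), bump, if_pos (Or.inl rfl), hg.up i le_rfl (by omega)]
    ring
  have h1' : ∀ x, RightExc f i x → f x = g x + 2 := fun x hx => by
    have := hx.1
    rw [h1 x hx, bump, if_neg (by omega)]
  have hn : ¬ RightExc f i (i + 2) := by
    intro hE
    have hall : ∀ k : ℕ, k + 2 ≤ 2 * r → RightExc f i (i + 2 + k) := by
      intro k
      induction k with
      | zero => intro _; simpa using hE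
      | succ k ih =>
        intro hk
        have hEk := ih (by omega)
        have e1 := h1' _ hEk
        push_cast
        rw [← add_assoc]
        by_contra hc
        have e2 := h2 _ hc
        rw [bump, if_neg (by omega)] at e2
        have e3 : f (i + 2 + k + 1) ≤ f i := by
          by_contra hc'
          refine hc ⟨by omega, fun z hz1 hz2 => ?_⟩
          rcases hz2.lt_or_eq with h3 | rfl
          · exact hEk.2 z hz1 (by omega)
          · omega
        have e4 := hf (i + 2 + k)
        rcases le_total (i + 2 + k + 1) (i + r) with h5 | h5
        · have g1 := hg.up (i + 2 + k + 1) (by omega) h5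
          omega
        · rcases h5.eq_or_lt with h6 | h6
          · have g1 := hg.up (i + 2 + k + 1) (by omega) h6.ge
            omega
          · have g1 := hg.down (i + 2 + k + 1) h5 (by omega)
            have g2 := hg.down (i + 2 + k) (by omega) (by omega)
            omega
    have hE2 := hall (2 * r - 2) (by omega)
    have e : i + 2 + ((2 * r - 2 : ℕ) : ℤ) = i + 2 * r := by omega
    rw [e] at hE2
    have e1 := h1' _ hE2
    have e2 := hg.down (i + 2 * r) (by omega) le_rfl
    have e3 := hE2.2 _ hE2.1 le_rfl
    omega
  funext x
  by_cases hx : x = i + 1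
  · rw [hx, h1' _ (rightExc_succ (by omega)), bump, if_pos (Or.inr rfl)]
  · rw [h2 x fun hE => ?_]
    · unfold bump
      exact if_congr (by omega) rfl rfl
    · have := hE.1
      exact hn ⟨by omega, fun z hz1 hz2 => hE.2 z hz1 (by omega)⟩

theorem lower_of_eq_bump {f g : ℤ → ℤ} (hg : IsArm g i h r) (hfg : f = bump g i (i + 1)) (x : ℤ) :
    (RightExc f i x → f x = bump g i i x + 2) ∧ (¬ RightExc f i x → f x = bump g i i x) := by
  have hr := hg.pos
  have g0 := hg.up i le_rfl (by omega)
  have g1 := hg.up (i + 1) (by omega) (by omega)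
  have f0 : f i = h + 2 := by rw [hfg, bump, if_pos (Or.inl rfl)]; omega
  have f1 : f (i + 1) = h + 3 := by rw [hfg, bump, if_pos (Or.inr rfl)]; omega
  have f2 : f (i + 2) ≤ h + 2 := by
    rw [hfg, bump, if_neg (by omega)]
    rcases le_total (i + 2) (i + r) with h3 | h3
    · have := hg.up (i + 2) (by omega) h3
      omega
    · have := hg.down (i + 2) h3 (by omega)
      omega
  constructor
  · intro hE
    have hx : x = i + 1 := by
      by_contra hc
      have := hE.1
      have := hE.2 (i + 2) (by omega) (by omega)
      omega
    rw [hx, f1, bump, if_neg (by omega), g1]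
    ring
  · intro hE
    have hx : x ≠ i + 1 := fun e => hE (e ▸ rightExc_succ (by omega))
    rw [hfg]
    unfold bump
    exact if_congr (by omega) rfl rfl

end

section

open Classical in
/-- The value of the family `ψ` at the path with extended heights `f`; it is `0` if there is no
such path. -/
def lookup {N : ℕ} {V : Type*} [Zero V] (ψ : DyckPath N → V) (f : ℤ → ℤ) : V :=
  if h : ∃ β : DyckPath N, hz β = f then ψ h.choose else 0

theorem lookup_hz {N : ℕ} {V : Type*} [Zero V] (ψ : DyckPath N → V) {β : DyckPath N} {f : ℤ → ℤ}
    (h : hz β = f) : lookup ψ f = ψ β := by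
  have hex : ∃ β : DyckPath N, hz β = f := ⟨β, h⟩
  rw [lookup, dif_pos hex]
  congr 1
  exact hz_injective (hex.choose_spec.trans h.symm)

theorem lookup_of_forall_ne {N : ℕ} {V : Type*} [Zero V] (ψ : DyckPath N → V) {f : ℤ → ℤ}
    (h : ∀ β : DyckPath N, hz β ≠ f) : lookup ψ f = 0 := by
  rw [lookup, dif_neg fun ⟨β, hβ⟩ => h β hβ]

theorem apply_lookup {N : ℕ} {V W : Type*} [Zero V] [Zero W] (ψ : DyckPath N → V) (f : ℤ → ℤ)
    (g : V → W) (hg : g 0 = 0) : g (lookup ψ f) = lookup (fun β => g (ψ β)) f := by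
  unfold lookup
  split_ifs
  · rfl
  · exact hg

variable {m : ℕ} {α β γ : DyckPath (m + 1)} {h : ℤ} {l r : ℕ}

theorem hz_raise_eq_bump (k : Fin m) (hmin : IsLocMin α k) :
    hz (raise α k hmin) = bump (hz α) ((k : ℤ) + 1) ((k : ℤ) + 1) := by
  funext x
  rw [hz_raise, bump]
  exact if_congr (by omega) rfl rfl

theorem hz_peel_eq_of_right (k : Fin m) (hβ : 1 ≤ β.height (pos k))
    (hR : IsArm (hz α) ((k : ℤ) + 1) h r)
    (h3 : hz β ((k : ℤ) + 1 - 1) = hz β ((k : ℤ) + 1) - 1)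
    (h4 : hz β ((k : ℤ) + 1 + 1) = hz β ((k : ℤ) + 1) + 1) :
    hz (peel β k hβ) = bump (hz α) ((k : ℤ) + 1) ((k : ℤ) + 1) ↔
      hz β = bump (hz α) ((k : ℤ) + 1) ((k : ℤ) + 1 + 1) := by
  classical
  have e := hz_peel_of_up k hβ h3
  constructor
  · intro hp
    refine eq_bump_of_lower (hz_step β) hR h4 (fun x hx => ?_) fun x hx => ?_
    · have := e x
      rw [if_pos hx] at this
      rw [← hp]
      omega
    · have := e x
      rw [if_neg hx] at this
      rw [← hp]
      omega
  · intro hb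
    funext x
    have := lower_of_eq_bump hR hb x
    rw [e]
    split_ifs with hE
    · have := this.1 hE
      omega
    · exact this.2 hE

theorem hz_peel_eq_of_left (k : Fin m) (hβ : 1 ≤ β.height (pos k))
    (hL : IsArm (fun x => hz α (-x)) (-((k : ℤ) + 1)) h l)
    (h3 : hz β ((k : ℤ) + 1 - 1) = hz β ((k : ℤ) + 1) + 1)
    (h4 : hz β ((k : ℤ) + 1 + 1) = hz β ((k : ℤ) + 1) - 1) :
    hz (peel β k hβ) = bump (hz α) ((k : ℤ) + 1) ((k : ℤ) + 1) ↔
      hz β = bump (hz α) ((k : ℤ) + 1) ((k : ℤ) + 1 - 1) := by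
  classical
  have e := hz_peel_of_down k hβ h4
  generalize (k : ℤ) + 1 = i at *
  have eb : ∀ x y, bump (fun z => hz α (-z)) (-i) (-y) (-x) = bump (hz α) i y x := fun x y => by
    simp only [bump, neg_inj, neg_neg]
  have e1 : -i + 1 = -(i - 1) := by ring
  constructor
  · intro hp
    have := eq_bump_of_lower (f := fun z => hz β (-z)) (fun x => by
      have := hz_step β (-x - 1)
      rw [sub_add_cancel] at this
      have e : -(x + 1) = -x - 1 := by ring
      rw [e]
      omega) hL (by simpa [e1] using h3) (fun x hx => ?_) fun x hx => ?_
    · funext x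
      have := congrFun this (-x)
      rw [e1, eb, neg_neg] at this
      exact this
    · have := e (-x)
      rw [neg_neg, if_pos hx] at this
      have e2 := eb (-x) i
      rw [neg_neg] at e2
      rw [e2, ← hp]
      omega
    · have := e (-x)
      rw [neg_neg, if_neg hx] at this
      have e2 := eb (-x) i
      rw [neg_neg] at e2
      rw [e2, ← hp]
      omega
  · intro hb
    funext x
    have := lower_of_eq_bump hL (f := fun z => hz β (-z)) (by
      funext x
      have e2 := eb (-x) (i - 1)
      rw [neg_neg] at e2
      rw [e1, e2, hb]) (-x)
    rw [eb, neg_neg] at this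
    rw [e]
    split_ifs with hE
    · have := this.1 hE
      omega
    · exact this.2 hE

/-- The entries of the matrix of `e_k` in the row of the path that has one tile more than `α`, when
the local minimum of `α` has arms on both sides. -/
theorem tlGen_apply_raise (η : ℂ) (k : Fin m) (hmin : IsLocMin α k)
    (hR : IsArm (hz α) ((k : ℤ) + 1) h r)
    (hL : IsArm (fun x => hz α (-x)) (-((k : ℤ) + 1)) h l) (v : States m) :
    tlGen η k v (raise α k hmin) = -qnum η 2 * v (raise α k hmin) + v α +
      lookup v (bump (hz α) ((k : ℤ) + 1) ((k : ℤ) + 1 + 1)) +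
      lookup v (bump (hz α) ((k : ℤ) + 1) ((k : ℤ) + 1 - 1)) := by
  classical
  have hadd : ∀ (f : ℤ → ℤ) (u v : States m), lookup (u + v) f = lookup u f + lookup v f := by
    intro f u v
    unfold lookup
    split_ifs <;> simp
  have hmin' := (isLocMin_iff k).1 hmin
  have hr := hz_raise_eq_bump k hmin
  have hmx := (isLocMax_iff k).1 (isMaxAt_raise k hmin)
  induction v using Finsupp.induction_linear with
  | zero => simp [lookup]
  | add u v hu hv =>
    rw [map_add, Finsupp.add_apply, hu, hv, hadd, hadd, Finsupp.add_apply,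
      Finsupp.add_apply]
    ring
  | single β c =>
    have hl : ∀ f, lookup (⇑(Finsupp.single β c : States m)) f = if hz β = f then c else 0 := by
      intro f
      split_ifs with hf
      · rw [lookup_hz _ hf, Finsupp.single_eq_same]
      · by_cases hex : ∃ δ : DyckPath (m + 1), hz δ = f
        · obtain ⟨δ, hδ⟩ := hex
          rw [lookup_hz _ hδ]
          exact Finsupp.single_eq_of_ne' fun e => hf (e ▸ hδ)
        · exact lookup_of_forall_ne _ fun δ hδ => hex ⟨δ, hδ⟩
    have hs : ∀ δ : DyckPath (m + 1), (Finsupp.single β c : States m) δ =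
        if hz β = hz δ then c else 0 := fun δ => by
      rw [Finsupp.single_apply]
      exact if_congr hz_injective.eq_iff.symm rfl rfl
    have ht : ∀ δ d, (c • (Finsupp.single δ d : States m)) (raise α k hmin) =
        if hz δ = hz (raise α k hmin) then c * d else 0 := fun δ d => by
      rw [Finsupp.smul_apply, Finsupp.single_apply, smul_eq_mul, mul_ite, mul_zero]
      exact if_congr hz_injective.eq_iff.symm rfl rfl
    rw [tlGen, Finsupp.linearCombination_single, tlOnPath, hl, hl, hs, hs]
    generalize hx : (k : ℤ) + 1 = x at *
    unfold IsMinAt at hmin'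
    -- The two long bumps go uphill and downhill at `x`.
    have hbR : hz β = bump (hz α) x (x + 1) → hz β (x - 1) = hz β x - 1 ∧
        hz β (x + 1) = hz β x + 1 := fun e => by
      rw [e]
      unfold bump
      rw [if_neg (by omega), if_pos (by omega), if_pos (by omega)]
      omega
    have hbL : hz β = bump (hz α) x (x - 1) → hz β (x - 1) = hz β x + 1 ∧
        hz β (x + 1) = hz β x - 1 := fun e => by
      rw [e]
      unfold bump
      rw [if_pos (by omega), if_pos (by omega), if_neg (by omega)]
      omega
    by_cases h1 : IsLocMin β k
    · have h1' := (isLocMin_iff k).1 h1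
      rw [hx] at h1'
      have n1 : hz β ≠ hz (raise α k hmin) := fun e => by
        rw [e] at h1'
        exact absurd (h1'.1.symm.trans hmx.1) (by omega)
      have n2 : hz β ≠ bump (hz α) x (x + 1) := fun e => by
        have := hbR e
        have := h1'.1
        omega
      have n3 : hz β ≠ bump (hz α) x (x - 1) := fun e => by
        have := hbL e
        have := h1'.2
        omega
      rw [dif_pos h1, ht, if_neg n1, if_neg n2, if_neg n3, mul_one]
      have : hz (raise β k h1) = hz (raise α k hmin) ↔ hz β = hz α := by
        constructor
        · intro e
          funext z
          have e1 := congrFun e z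
          rw [hz_raise, hz_raise] at e1
          split_ifs at e1 <;> omega
        · intro e
          funext z
          rw [hz_raise, hz_raise, e]
      rw [if_congr this rfl rfl]
      ring
    rw [dif_neg h1]
    have h1' : ¬ IsMinAt (hz β) x := fun hc => h1 ((isLocMin_iff k).2 (hx ▸ hc))
    have n0 : hz β ≠ hz α := fun e => h1' (e ▸ hmin')
    by_cases h2 : IsLocMax β k
    · have h2' := (isLocMax_iff k).1 h2
      rw [hx] at h2'
      have n2 : hz β ≠ bump (hz α) x (x + 1) := fun e => by
        have := hbR e
        have := h2'.2
        omega
      have n3 : hz β ≠ bump (hz α) x (x - 1) := fun e => by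
        have := hbL e
        have := h2'.1
        omega
      rw [dif_pos h2, ht, if_neg n0, if_neg n2, if_neg n3, add_zero, add_zero, add_zero,
        mul_ite, mul_zero, mul_comm]
    · have h2' : ¬ IsMaxAt (hz β) x := fun hc => h2 ((isLocMax_iff k).2 (hx ▸ hc))
      have n1 : hz β ≠ hz (raise α k hmin) := fun e => h2' (e ▸ hmx)
      rw [dif_neg h2, ht, if_neg n0, if_neg n1, mul_one, mul_zero, zero_add, zero_add, hr]
      rcases slope_cases β h1' h2' with ⟨h3, h4⟩ | ⟨h3, h4⟩
      · have n3 : hz β ≠ bump (hz α) x (x - 1) := fun e => by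
          have := hbL e
          omega
        have := hz_peel_eq_of_right k (one_le_of_slope β k h1 h2) (by rw [hx]; exact hR)
          (by rw [hx]; exact h3) (by rw [hx]; exact h4)
        rw [hx] at this
        rw [if_neg n3, add_zero]
        exact if_congr this rfl rfl
      · have n2 : hz β ≠ bump (hz α) x (x + 1) := fun e => by
          have := hbR e
          omega
        have := hz_peel_eq_of_left k (one_le_of_slope β k h1 h2) (by rw [hx]; exact hL)
          (by rw [hx]; exact h3) (by rw [hx]; exact h4)
        rw [hx] at this
        rw [if_neg n2, zero_add]
        exact if_congr this rfl rfl

end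

/-! ### The operators `a_i` on the functions on an admissible domain -/

section

/-- The coefficient `[d + 1] / [d]` of `π_i` in `a_i`, where `d = x_i - x_{i+1}`; the other
coefficient `[d - 1] / [d]` is its value at `-d`. -/
def coef (η d : ℂ) : ℂ := qnum η (d + 1) / qnum η d

theorem qnum_neg (η u : ℂ) : qnum η (-u) = -qnum η u := by
  unfold qnum
  rw [mul_neg, neg_neg, ← neg_div, neg_sub]

theorem coef_neg (η d : ℂ) : coef η (-d) = qnum η (d - 1) / qnum η d := by
  rw [coef, qnum_neg, show -d + 1 = -(d - 1) by ring, qnum_neg, neg_div_neg_eq]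

theorem coef_add_coef_neg {η d : ℂ} (hd : qnum η d ≠ 0) : coef η d + coef η (-d) = qnum η 2 := by
  rw [coef_neg, coef, ← add_div, div_eq_iff hd]
  have h := qnum_add η 1 d
  have hq1 : qnum η 1 = 1 := by
    have hk : Complex.exp η - Complex.exp (-η) ≠ 0 := by
      intro hk
      simp [qnum, hk] at hd
    simp only [qnum, mul_one]
    exact div_self hk
  rw [hq1, show (1 : ℂ) + 1 = 2 by norm_num, add_comm 1 d] at h
  rw [h]
  ring

/-- The coefficient as a rational function of `exp (2 η x)` and `exp (2 η y)`. -/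
theorem coef_sub {η x y : ℂ} (hd : qnum η (x - y) ≠ 0) :
    Complex.exp (η * x) ^ 2 ≠ Complex.exp (η * y) ^ 2 ∧
    coef η (x - y) = (Complex.exp (η * x) ^ 2 * Complex.exp η -
      Complex.exp (η * y) ^ 2 * (Complex.exp η)⁻¹) /
      (Complex.exp (η * x) ^ 2 - Complex.exp (η * y) ^ 2) := by
  have e1 : η * (x - y) = η * x - η * y := by ring
  have e2 : η * (x - y + 1) = η * x - η * y + η := by ring
  have e3 : -(η * x - η * y + η) = -(η * x) + η * y - η := by ring
  have e4 : -(η * x - η * y) = -(η * x) + η * y := by ring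
  simp only [coef, qnum, e1, e2, e3, e4, Complex.exp_add, Complex.exp_neg, Complex.exp_sub] at hd ⊢
  have h1 := Complex.exp_ne_zero (η * x)
  have h2 := Complex.exp_ne_zero (η * y)
  have h3 := Complex.exp_ne_zero η
  generalize Complex.exp (η * x) = A at *
  generalize Complex.exp (η * y) = B at *
  generalize Complex.exp η = E at *
  obtain ⟨hd1, hk⟩ := div_ne_zero_iff.1 hd
  have hne : A ^ 2 ≠ B ^ 2 := by
    intro h
    apply hd1
    field_simp
    rw [h, sub_self, mul_zero]
  have hne' := sub_ne_zero.2 hne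
  refine ⟨hne, ?_⟩
  rw [div_div_div_cancel_right₀ hk, div_eq_div_iff hd1 hne']
  field_simp

variable {m : ℕ} {η lam : ℂ} {U : Set (Fin (m + 1) → ℂ)}

/-- The exchange of neighbouring variables on an admissible domain. -/
def swapVar (hU : IsAdmissibleDomain η lam U) (k : Fin m) (x : U) : U :=
  ⟨exchange k x.1, hU.exchange_mem k x.1 x.2⟩

/-- The operator `a_i` on the functions on an admissible domain. -/
def aRes (hU : IsAdmissibleDomain η lam U) (k : Fin m) : Module.End ℂ (U → ℂ) where
  toFun f x := coef η (x.1 k.castSucc - x.1 k.succ) * f (swapVar hU k x) +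
    coef η (x.1 k.succ - x.1 k.castSucc) * f x
  map_add' f g := by
    funext x
    simp only [Pi.add_apply]
    ring
  map_smul' c f := by
    funext x
    simp only [Pi.smul_apply, smul_eq_mul, RingHom.id_apply]
    ring

theorem aRes_apply (hU : IsAdmissibleDomain η lam U) (k : Fin m) (f : U → ℂ) (x : U) :
    aRes hU k f x = coef η (x.1 k.castSucc - x.1 k.succ) * f (swapVar hU k x) +
      coef η (x.1 k.succ - x.1 k.castSucc) * f x := rfl

/-- Restriction to the domain intertwines the operators. -/
theorem aOp_restrict (hU : IsAdmissibleDomain η lam U) (k : Fin m)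
    (ψ : (Fin (m + 1) → ℂ) → ℂ) :
    (fun x : U => aOp η k ψ x.1) = aRes hU k (fun x : U => ψ x.1) := by
  funext x
  rw [aRes_apply, ← neg_sub (x.1 k.castSucc), coef_neg]
  rfl

theorem swapVar_left (hU : IsAdmissibleDomain η lam U) (k : Fin m) (x : U) :
    (swapVar hU k x).1 k.castSucc = x.1 k.succ := by
  simp [swapVar, exchange]

theorem swapVar_right (hU : IsAdmissibleDomain η lam U) (k : Fin m) (x : U) :
    (swapVar hU k x).1 k.succ = x.1 k.castSucc := by
  simp [swapVar, exchange]

theorem swapVar_of_ne (hU : IsAdmissibleDomain η lam U) (k : Fin m) (x : U) {j : Fin (m + 1)}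
    (h1 : j ≠ k.castSucc) (h2 : j ≠ k.succ) : (swapVar hU k x).1 j = x.1 j := by
  simp [swapVar, exchange, Equiv.swap_apply_of_ne_of_ne h1 h2]

theorem swapVar_swapVar (hU : IsAdmissibleDomain η lam U) (k : Fin m) (x : U) :
    swapVar hU k (swapVar hU k x) = x := by
  apply Subtype.ext
  funext j
  simp [swapVar, exchange]

theorem qnum_sub_ne (hU : IsAdmissibleDomain η lam U) (x : U) {i j : Fin (m + 1)} (h : i ≠ j) :
    qnum η (x.1 i - x.1 j) ≠ 0 := hU.sub_ne x.1 x.2 i j h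

theorem aRes_sq (hU : IsAdmissibleDomain η lam U) (k : Fin m) :
    aRes hU k * aRes hU k = qnum η 2 • aRes hU k := by
  refine LinearMap.ext fun f => funext fun x => ?_
  simp only [Module.End.mul_apply, LinearMap.smul_apply, Pi.smul_apply, smul_eq_mul, aRes_apply,
    swapVar_swapVar, swapVar_left, swapVar_right]
  have h := coef_add_coef_neg (qnum_sub_ne hU x (Fin.castSucc_lt_succ (i := k)).ne)
  rw [neg_sub] at h
  rw [← h]
  ring

theorem aRes_comm (hU : IsAdmissibleDomain η lam U) {k k' : Fin m} (h : (k : ℕ) + 1 < k') :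
    Commute (aRes hU k) (aRes hU k') := by
  have n1 : k'.castSucc ≠ k.castSucc := by simp [Fin.ext_iff]; omega
  have n2 : k'.castSucc ≠ k.succ := by simp [Fin.ext_iff]; omega
  have n3 : k'.succ ≠ k.castSucc := by simp [Fin.ext_iff]; omega
  have n4 : k'.succ ≠ k.succ := by simp [Fin.ext_iff]; omega
  have hs : ∀ x, swapVar hU k (swapVar hU k' x) = swapVar hU k' (swapVar hU k x) := by
    intro x
    apply Subtype.ext
    funext j
    by_cases h1 : j = k.castSucc
    · rw [h1, swapVar_left, swapVar_of_ne _ _ _ n2.symm n4.symm,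
        swapVar_of_ne _ _ _ n1.symm n3.symm, swapVar_left]
    by_cases h2 : j = k.succ
    · rw [h2, swapVar_right, swapVar_of_ne _ _ _ n1.symm n3.symm,
        swapVar_of_ne _ _ _ n2.symm n4.symm, swapVar_right]
    rw [swapVar_of_ne _ _ _ h1 h2]
    by_cases h3 : j = k'.castSucc
    · rw [h3, swapVar_left, swapVar_left, swapVar_of_ne _ _ _ n3 n4]
    by_cases h4 : j = k'.succ
    · rw [h4, swapVar_right, swapVar_right, swapVar_of_ne _ _ _ n1 n2]
    rw [swapVar_of_ne _ _ _ h3 h4, swapVar_of_ne _ _ _ h3 h4, swapVar_of_ne _ _ _ h1 h2]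
  refine LinearMap.ext fun f => funext fun x => ?_
  simp only [Module.End.mul_apply, aRes_apply, swapVar_of_ne _ _ _ n1 n2, swapVar_of_ne _ _ _ n3 n4,
    swapVar_of_ne _ _ _ n1.symm n3.symm, swapVar_of_ne _ _ _ n2.symm n4.symm, hs]
  ring

theorem aRes_braid (hU : IsAdmissibleDomain η lam U) {k k' : Fin m} (h : (k' : ℕ) = k + 1) :
    aRes hU k * aRes hU k' * aRes hU k - aRes hU k =
      aRes hU k' * aRes hU k * aRes hU k' - aRes hU k' := by
  have e : k'.castSucc = k.succ := by simp [Fin.ext_iff, h]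
  have n1 : k.castSucc ≠ k.succ := (Fin.castSucc_lt_succ (i := k)).ne
  have n2 : k.castSucc ≠ k'.succ := by simp [Fin.ext_iff]; omega
  have n3 : k.succ ≠ k'.succ := by simp [Fin.ext_iff]; omega
  have v1 : ∀ x, (swapVar hU k' x).1 k.succ = x.1 k'.succ := fun x => by
    rw [← e, swapVar_left]
  have v2 : ∀ x, (swapVar hU k' x).1 k'.succ = x.1 k.succ := fun x => by
    rw [swapVar_right, e]
  have v3 : ∀ x, (swapVar hU k' x).1 k.castSucc = x.1 k.castSucc := fun x =>
    swapVar_of_ne _ _ _ (e ▸ n1) n2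
  have v4 : ∀ x, (swapVar hU k x).1 k'.succ = x.1 k'.succ := fun x =>
    swapVar_of_ne _ _ _ n2.symm n3.symm
  have hs : ∀ x, swapVar hU k (swapVar hU k' (swapVar hU k x)) =
      swapVar hU k' (swapVar hU k (swapVar hU k' x)) := by
    intro x
    apply Subtype.ext
    funext j
    by_cases h1 : j = k.castSucc
    · rw [h1, swapVar_left, v1, v4, v3, swapVar_left, v1]
    by_cases h2 : j = k.succ
    · rw [h2, swapVar_right, v3, swapVar_left, v1, v4, v2]
    by_cases h3 : j = k'.succ
    · rw [h3, v4, v2, swapVar_right, v2, swapVar_right, v3]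
    have h4 : j ≠ k'.castSucc := e ▸ h2
    simp only [swapVar_of_ne _ _ _ h1 h2, swapVar_of_ne _ _ _ h4 h3]
  refine LinearMap.ext fun f => funext fun x => ?_
  simp only [Module.End.mul_apply, LinearMap.sub_apply, Pi.sub_apply, aRes_apply, e, v1, v2, v3, v4,
    swapVar_left, swapVar_right, swapVar_swapVar, hs]
  obtain ⟨d1, c1⟩ := coef_sub (qnum_sub_ne hU x n1)
  obtain ⟨-, c1'⟩ := coef_sub (qnum_sub_ne hU x n1.symm)
  obtain ⟨d2, c2⟩ := coef_sub (qnum_sub_ne hU x n2)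
  obtain ⟨-, c2'⟩ := coef_sub (qnum_sub_ne hU x n2.symm)
  obtain ⟨d3, c3⟩ := coef_sub (qnum_sub_ne hU x n3)
  obtain ⟨-, c3'⟩ := coef_sub (qnum_sub_ne hU x n3.symm)
  rw [c1, c1', c2, c2', c3, c3']
  have h3 := Complex.exp_ne_zero η
  generalize Complex.exp (η * x.1 k.castSucc) ^ 2 = A at *
  generalize Complex.exp (η * x.1 k.succ) ^ 2 = B at *
  generalize Complex.exp (η * x.1 k'.succ) ^ 2 = C at *
  generalize Complex.exp η = E at *
  have d1' : A - B ≠ 0 := sub_ne_zero.2 d1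
  have d2' : A - C ≠ 0 := sub_ne_zero.2 d2
  have d3' : B - C ≠ 0 := sub_ne_zero.2 d3
  rw [← neg_sub A B, ← neg_sub A C, ← neg_sub B C]
  field_simp
  ring

/-- The operators `a_i`, with index the position in `ℤ`; they are `0` outside `[1, m]`. -/
def aInt (hU : IsAdmissibleDomain η lam U) (x : ℤ) : Module.End ℂ (U → ℂ) :=
  if hx : 1 ≤ x ∧ x ≤ m then aRes hU ⟨(x - 1).toNat, by omega⟩ else 0

theorem aInt_fin (hU : IsAdmissibleDomain η lam U) (k : Fin m) :
    aInt hU ((k : ℤ) + 1) = aRes hU k := by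
  have h : (1 : ℤ) ≤ (k : ℕ) + 1 ∧ ((k : ℕ) : ℤ) + 1 ≤ m := by omega
  simp [aInt, h]

theorem isHeckeFamily_aInt (hU : IsAdmissibleDomain η lam U) :
    IsHeckeFamily (qnum η 2) (aInt hU) 1 m where
  sq x := by
    unfold aInt
    split_ifs
    · exact aRes_sq hU _
    · simp
  comm x y h := by
    unfold aInt
    split_ifs
    · exact aRes_comm hU (by simp only; omega)
    · exact Commute.zero_right _
    · exact Commute.zero_left _
    · exact Commute.zero_left _
  braid x h1 h2 := by
    unfold aInt
    rw [dif_pos (by omega), dif_pos (by omega)]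
    exact aRes_braid hU (by simp only; omega)

/-! ### The qKZ equation for the components -/

variable {Ψ : (Fin (m + 1) → ℂ) → States m}

/-- The component of a solution at a path, as a function on the domain. -/
def comp (U : Set (Fin (m + 1) → ℂ)) (Ψ : (Fin (m + 1) → ℂ) → States m) (α : DyckPath (m + 1)) :
    U → ℂ := fun x => Ψ x.1 α

theorem aRes_comp (hU : IsAdmissibleDomain η lam U) (hΨ : IsQKZSolution η lam U Ψ) (k : Fin m)
    (α : DyckPath (m + 1)) (x : U) : aRes hU k (comp U Ψ α) x = -(tlGen η k (Ψ x.1) α) := by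
  have h := congrArg (fun v : States m => v α) (hΨ.bulk k x.1 x.2)
  have n : k.castSucc ≠ k.succ := (Fin.castSucc_lt_succ (i := k)).ne
  have h1 := qnum_sub_ne hU x n
  have h2 := hU.one_add_sub_ne x.1 x.2 _ _ n
  simp only [rMatrix, LinearMap.smul_apply, LinearMap.sub_apply, Module.End.one_apply,
    Finsupp.smul_apply, Finsupp.sub_apply, smul_eq_mul] at h
  rw [aRes_apply, ← neg_sub (x.1 k.castSucc), coef_neg, coef]
  have e : comp U Ψ α (swapVar hU k x) = Ψ (exchange k x.1) α := rfl
  rw [e, ← h, comp]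
  generalize x.1 k.castSucc - x.1 k.succ = u at *
  rw [show u - 1 = -(1 - u) by ring, qnum_neg, add_comm u 1]
  field_simp
  ring

theorem aRes_comp_eq_zero (hU : IsAdmissibleDomain η lam U) (hΨ : IsQKZSolution η lam U Ψ)
    (k : Fin m) {α : DyckPath (m + 1)} (hα : ¬ IsLocMax α k) : aRes hU k (comp U Ψ α) = 0 := by
  funext x
  rw [aRes_comp hU hΨ, tlGen_apply_of_not_isLocMax η k hα, neg_zero, Pi.zero_apply]

theorem aRes_comp_raise (hU : IsAdmissibleDomain η lam U) (hΨ : IsQKZSolution η lam U Ψ)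
    (k : Fin m) {α : DyckPath (m + 1)} (hmin : IsLocMin α k) {h : ℤ} {l r : ℕ}
    (hR : IsArm (hz α) ((k : ℤ) + 1) h r)
    (hL : IsArm (fun x => hz α (-x)) (-((k : ℤ) + 1)) h l) :
    comp U Ψ α = qnum η 2 • comp U Ψ (raise α k hmin) - aRes hU k (comp U Ψ (raise α k hmin)) -
      lookup (comp U Ψ) (bump (hz α) ((k : ℤ) + 1) ((k : ℤ) + 1 + 1)) -
      lookup (comp U Ψ) (bump (hz α) ((k : ℤ) + 1) ((k : ℤ) + 1 - 1)) := by
  funext x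
  have hl : ∀ f, lookup (comp U Ψ) f x = lookup (Ψ x.1) f := fun f =>
    apply_lookup (comp U Ψ) f (fun g : U → ℂ => g x) rfl
  simp only [Pi.sub_apply, Pi.smul_apply, smul_eq_mul, aRes_comp hU hΨ, hl,
    tlGen_apply_raise η k hmin hR hL]
  simp only [comp]
  ring

end

/-! ### Weights of rectangles -/

section

/-- The weight `[u + 1] / [u]` of a tile of content `u`; it is `1` for a missing tile. -/
def weight (η : ℂ) (u : ℕ) : ℂ := if u = 0 then 1 else ratio η u

theorem weight_zero (η : ℂ) : weight η 0 = 1 := by simp [weight]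

theorem weight_succ (η : ℂ) (u : ℕ) :
    weight η (u + 1) = qnum η ((u + 2 : ℕ) : ℂ) / qnum η ((u + 1 : ℕ) : ℂ) := by
  rw [weight, if_neg (by omega), ratio]
  push_cast
  rw [add_assoc, show (1 : ℂ) + 1 = 2 by norm_num]

theorem isBaxWeight_weight {η : ℂ} {K : ℕ} (h2 : qnum η 2 ≠ 0)
    (hq : ∀ k : ℕ, 1 ≤ k → k ≤ K + 1 → qnum η (k : ℂ) ≠ 0) :
    IsBaxWeight (qnum η 2) (weight η) K where
  one := by rw [weight, if_neg one_ne_zero, ratio_one h2]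
  mul u h1 hu := by
    rw [weight, if_neg (by omega), weight, if_neg (by omega)]
    exact ratio_mul (hq u h1 (by omega)) (by exact_mod_cast hq (u + 1) (by omega) (by omega))

theorem weight_ne_zero {η : ℂ} {K : ℕ}
    (hq : ∀ k : ℕ, 1 ≤ k → k ≤ K + 1 → qnum η (k : ℂ) ≠ 0) (k : ℕ) (h1 : 1 ≤ k) (hk : k ≤ K) :
    weight η k ≠ 0 := by
  obtain ⟨u, rfl⟩ : ∃ u, k = u + 1 := ⟨k - 1, by omega⟩
  rw [weight_succ]
  exact div_ne_zero (hq _ (by omega) (by omega)) (hq _ (by omega) (by omega))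

variable {η : ℂ} {l r : ℕ}

theorem prod_weight_add (a n : ℕ)
    (hq : ∀ k : ℕ, 1 ≤ k → k ≤ a + n → qnum η (k : ℂ) ≠ 0) (hn : 1 ≤ n) :
    ∏ b ∈ Finset.range n, weight η (a + 1 + b) =
      qnum η ((a + 1 + n : ℕ) : ℂ) / qnum η ((a + 1 : ℕ) : ℂ) := by
  induction n, hn using Nat.le_induction with
  | base =>
    rw [Finset.prod_range_one, add_zero, weight_succ]
  | succ n hn ih =>
    rw [Finset.prod_range_succ, ih fun k h1 h2 => hq k h1 (by omega),
      show a + 1 + n = a + n + 1 by ring, weight_succ, div_mul_eq_mul_div, mul_div_cancel₀]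
    · rw [show a + n + 2 = a + 1 + (n + 1) by ring]
    · exact hq _ (by omega) (by omega)

theorem prod_weight (n : ℕ) (hq : ∀ k : ℕ, 1 ≤ k → k ≤ n + 1 → qnum η (k : ℂ) ≠ 0)
    (h1 : qnum η 1 = 1) :
    ∏ b ∈ Finset.range (n + 1), weight η b = qnum η ((n + 1 : ℕ) : ℂ) := by
  rw [Finset.prod_range_succ', weight_zero, mul_one]
  rcases Nat.eq_zero_or_pos n with rfl | hn
  · simp [h1]
  · have := prod_weight_add 0 n (fun k h1 h2 => hq k h1 (by omega)) hn
    simp only [zero_add, Nat.cast_one, h1, div_one] at this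
    rw [add_comm n 1, ← this]
    exact Finset.prod_congr rfl fun b _ => by rw [add_comm]

theorem prod_weight_pred (n : ℕ) (hq : ∀ k : ℕ, 1 ≤ k → k ≤ n + 1 → qnum η (k : ℂ) ≠ 0)
    (h1 : qnum η 1 = 1) :
    ∏ b ∈ Finset.range (n + 2), weight η (b - 1) = qnum η ((n + 1 : ℕ) : ℂ) := by
  rw [Finset.prod_range_succ', Nat.zero_sub, weight_zero, mul_one, ← prod_weight n hq h1]
  rfl

/-- The product of the weights over an `l × r` rectangle with contents `G`. -/
def rectWeight (η : ℂ) (l r : ℕ) (G : ℕ → ℕ → ℕ) : ℂ :=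
  ∏ a ∈ Finset.range l, ∏ b ∈ Finset.range r, weight η (G a b)

/-- The product of `[a + r] / [a]` for `1 ≤ a ≤ l`, the weight of `l` full rows of length `r`. -/
def sideWeight (η : ℂ) (l r : ℕ) : ℂ :=
  ∏ a ∈ Finset.range l, (qnum η ((a + 1 + r : ℕ) : ℂ) / qnum η ((a + 1 : ℕ) : ℂ))

theorem rectWeight_full (hr : 1 ≤ r)
    (hq : ∀ k : ℕ, 1 ≤ k → k ≤ l + 1 + r → qnum η (k : ℂ) ≠ 0) :
    rectWeight η (l + 1) r (fun a b => a + b + 1) =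
      sideWeight η l r * (qnum η ((l + 1 + r : ℕ) : ℂ) / qnum η ((l + 1 : ℕ) : ℂ)) := by
  rw [sideWeight, ← Finset.prod_range_succ
    (fun a : ℕ => qnum η ((a + 1 + r : ℕ) : ℂ) / qnum η ((a + 1 : ℕ) : ℂ))]
  refine Finset.prod_congr rfl fun a ha => ?_
  rw [Finset.mem_range] at ha
  rw [← prod_weight_add a r (fun k h1 h2 => hq k h1 (by omega)) hr]
  exact Finset.prod_congr rfl fun b _ => by rw [add_right_comm]

theorem rectWeight_row (g : ℕ → ℕ) (hr : 1 ≤ r)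
    (hq : ∀ k : ℕ, 1 ≤ k → k ≤ l + 1 + r → qnum η (k : ℂ) ≠ 0) :
    rectWeight η (l + 1) r (fun a b => if a = 0 then g b else a + b) =
      sideWeight η l r * ∏ b ∈ Finset.range r, weight η (g b) := by
  rw [rectWeight, Finset.prod_range_succ', sideWeight]
  congr 1
  refine Finset.prod_congr rfl fun a ha => ?_
  rw [Finset.mem_range] at ha
  rw [← prod_weight_add a r (fun k h1 h2 => hq k h1 (by omega)) hr]
  rfl

theorem rectWeight_column (hq : ∀ k : ℕ, 1 ≤ k → k ≤ l + 2 + r → qnum η (k : ℂ) ≠ 0)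
    (h1 : qnum η 1 = 1) (hr : 1 ≤ r) :
    rectWeight η (l + 2) r (fun a b => if b = 0 then a - 1 else a + b) =
      sideWeight η (l + 1) r * (qnum η ((l + 1 : ℕ) : ℂ) * qnum η (r : ℂ) /
        qnum η ((l + 2 : ℕ) : ℂ)) := by
  obtain ⟨n, rfl⟩ : ∃ n, r = n + 1 := ⟨r - 1, by omega⟩
  have e : ∀ a ∈ Finset.range (l + 2),
      ∏ b ∈ Finset.range (n + 1), weight η (if b = 0 then a - 1 else a + b) =
        weight η (a - 1) * (qnum η ((a + (n + 1) : ℕ) : ℂ) / qnum η ((a + 1 : ℕ) : ℂ)) := by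
    intro a ha
    rw [Finset.mem_range] at ha
    rw [Finset.prod_range_succ', if_pos rfl, mul_comm]
    congr 1
    rcases Nat.eq_zero_or_pos n with rfl | hn
    · rw [Finset.prod_range_zero, zero_add, div_self (hq _ (by omega) (by omega))]
    · rw [show a + (n + 1) = a + 1 + n by ring,
        ← prod_weight_add a n (fun k h1 h2 => hq k h1 (by omega)) hn]
      refine Finset.prod_congr rfl fun b _ => ?_
      rw [if_neg (by omega), add_assoc, add_comm 1 b]
  rw [rectWeight, Finset.prod_congr rfl e, Finset.prod_mul_distrib,
    prod_weight_pred l (fun k h1 h2 => hq k h1 (by omega)) h1, Finset.prod_div_distrib, sideWeight,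
    Finset.prod_div_distrib, Finset.prod_range_succ' (fun a : ℕ => qnum η ((a + (n + 1) : ℕ) : ℂ)),
    Finset.prod_range_succ (fun a : ℕ => qnum η ((a + 1 : ℕ) : ℂ)) (l + 1), zero_add]
  have h2 : ∏ a ∈ Finset.range (l + 1), qnum η ((a + 1 : ℕ) : ℂ) ≠ 0 :=
    Finset.prod_ne_zero_iff.2 fun a ha => by
      rw [Finset.mem_range] at ha
      exact hq _ (by omega) (by omega)
  have h3 := hq (l + 2) (by omega) (by omega)
  rw [show l + 1 + 1 = l + 2 by rfl]
  field_simp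

/-- The image of `ψ_α = h_i(1) ψ_{α⁺} - ψ_β - ψ_{β'}` under the Jones-Wenzl element; the two
factors `qnum η (r - 1)` and `qnum η (l - 1)` vanish when there is no path `β` or `β'`. -/
theorem rectWeight_relation (hl : 1 ≤ l) (hr : 1 ≤ r)
    (hq : ∀ k : ℕ, 1 ≤ k → k ≤ l + r → qnum η (k : ℂ) ≠ 0) :
    rectWeight η l r (fun a b => a + b + 1) =
      qnum η 2 * rectWeight η l r (fun a b => a + b) -
      (if r = 1 then 0 else rectWeight η l r (fun a b => if a = 0 then b - 1 else a + b)) -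
      (if l = 1 then 0 else rectWeight η l r (fun a b => if b = 0 then a - 1 else a + b)) := by
  have h2 : qnum η 2 ≠ 0 := by exact_mod_cast hq 2 (by omega) (by omega)
  have h1 := qnum_one h2
  obtain ⟨l, rfl⟩ : ∃ k, l = k + 1 := ⟨l - 1, by omega⟩
  have hrow : rectWeight η (l + 1) r (fun a b => a + b) = sideWeight η l r * qnum η (r : ℂ) := by
    obtain ⟨n, rfl⟩ : ∃ k, r = k + 1 := ⟨r - 1, by omega⟩
    rw [← prod_weight n (fun k h1 h2 => hq k h1 (by omega)) h1, ← rectWeight_row (fun b => b) hr hq]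
    congr 1
    funext a b
    split_ifs with ha
    · rw [ha, zero_add]
    · rfl
  have hR : (if r = 1 then 0 else
      rectWeight η (l + 1) r (fun a b => if a = 0 then b - 1 else a + b)) =
        sideWeight η l r * qnum η ((r : ℂ) - 1) := by
    split_ifs with h
    · rw [h, Nat.cast_one, sub_self, qnum_zero, mul_zero]
    · obtain ⟨n, rfl⟩ : ∃ k, r = k + 2 := ⟨r - 2, by omega⟩
      rw [rectWeight_row (fun b => b - 1) hr hq,
        prod_weight_pred n (fun k h1 h2 => hq k h1 (by omega)) h1]
      congr 2
      push_cast
      ring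
  have hL : (if l + 1 = 1 then 0 else
      rectWeight η (l + 1) r (fun a b => if b = 0 then a - 1 else a + b)) =
        sideWeight η l r * (qnum η (l : ℂ) * qnum η (r : ℂ) / qnum η ((l + 1 : ℕ) : ℂ)) := by
    split_ifs with h
    · have : l = 0 := by omega
      rw [this, Nat.cast_zero, qnum_zero, zero_mul, zero_div, mul_zero]
    · obtain ⟨n, rfl⟩ : ∃ k, l = k + 1 := ⟨l - 1, by omega⟩
      exact rectWeight_column hq h1 hr
  rw [rectWeight_full hr hq, hrow, hR, hL]
  have hl0 := hq (l + 1) (by omega) (by omega)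
  have e1 := qnum_add η ((l + 1 : ℕ) : ℂ) (r : ℂ)
  have e2 := qnum_add η 1 ((l + 1 : ℕ) : ℂ)
  rw [h1, one_mul, show (1 : ℂ) + 1 = 2 by norm_num, add_comm 1 ((l + 1 : ℕ) : ℂ),
    show ((l + 1 : ℕ) : ℂ) - 1 = l by push_cast; ring] at e2
  rw [e2] at e1
  rw [Nat.cast_add (l + 1) r, e1]
  field_simp
  ring

end

/-! ### Orders of the tiles -/

section

variable {m : ℕ} {α γ δ : DyckPath (m + 1)} {i h : ℤ} {l r : ℕ}

/-- A list of all the tiles in which a tile on top of another one comes later. -/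
structure IsTileList (α : DyckPath (m + 1)) (L : List (ℤ × ℤ)) : Prop where
  nodup : L.Nodup
  mem_iff : ∀ t, t ∈ L ↔ TileAt α t
  sorted : L.Pairwise BoxOrder

theorem contentAt_lt_of_neighbour {s : ℤ} (hs : s = 1 ∨ s = -1) {x y : ℤ}
    (ht : TileAt α (x, y)) : contentAt α (x + s, y - 1) < contentAt α (x, y) := by
  rw [contentAt_of_tileAt ht]
  rcases hs with rfl | rfl
  · have := le_max_right (contentAt α (x - 1, y - 1)) (contentAt α (x + 1, y - 1))
    omega
  · have := le_max_left (contentAt α (x - 1, y - 1)) (contentAt α (x + 1, y - 1))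
    rw [← sub_eq_add_neg]
    omega

theorem TileAt.of_between {x y z : ℤ} (h1 : TileAt α (x, y)) (h2 : TileAt α (x, z)) {w : ℤ}
    (hw : y ≤ w) (hw' : w ≤ z) (hp : Even (w - y)) : TileAt α (x, w) := by
  obtain ⟨p1, p2, p3⟩ := h1
  obtain ⟨q1, q2, q3⟩ := h2
  simp only at *
  rw [Int.odd_iff] at p1
  rw [Int.even_iff] at hp
  refine ⟨?_, ?_, ?_⟩ <;> simp only
  · rw [Int.odd_iff]; omega
  · omega
  · omega

theorem TileAt.side {s : ℤ} (hs : s = 1 ∨ s = -1) {x y : ℤ} (h1 : TileAt α (x, y))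
    (h2 : TileAt α (x, y - 2)) : TileAt α (x + s, y - 1) := by
  obtain ⟨p1, p2, p3⟩ := h1
  have q2 := h2.2.1
  simp only at *
  rw [Int.odd_iff] at p1
  have hΩ : hz (maxPath (m + 1)) x - 1 ≤ hz (maxPath (m + 1)) (x + s) ∧
      hz α (x + s) ≤ hz α x + 1 := by
    rcases hs with rfl | rfl
    · have := hz_lipschitz (maxPath (m + 1)) (show x ≤ x + 1 by omega)
      have := hz_lipschitz α (show x ≤ x + 1 by omega)
      omega
    · have := hz_lipschitz (maxPath (m + 1)) (show x + -1 ≤ x by omega)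
      have := hz_lipschitz α (show x + -1 ≤ x by omega)
      omega
  refine ⟨?_, ?_, ?_⟩ <;> simp only
  · rw [Int.odd_iff]; omega
  · omega
  · omega

theorem contentAt_le_of_column (k : ℕ) : ∀ {x y : ℤ}, TileAt α (x, y) →
    contentAt α (x, y - 2 * k) ≤ contentAt α (x, y) ∧
      (1 ≤ k → TileAt α (x, y - 2 * k) → contentAt α (x, y - 2 * k) < contentAt α (x, y)) := by
  induction k with
  | zero => intro x y _; simp
  | succ k ih =>
    intro x y ht
    by_cases hk : TileAt α (x, y - 2 * (k + 1 : ℕ))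
    swap
    · exact ⟨by rw [contentAt_of_not_tileAt hk]; exact Nat.zero_le _, fun _ h => absurd h hk⟩
    have e : y - 2 * ((k + 1 : ℕ) : ℤ) = y - 2 * k - 2 := by push_cast; ring
    rw [e] at hk ⊢
    have hk' : TileAt α (x, y - 2 * k) := hk.of_between ht (by omega) (by omega)
      (by rw [Int.even_iff]; omega)
    have h1 := (ih ht).1
    have h2 := contentAt_lt_of_neighbour (Or.inl rfl) hk'
    have h3 := contentAt_lt_of_neighbour (Or.inr rfl) (hk'.side (Or.inl rfl) hk)
    have e1 : x + 1 + -1 = x := by ring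
    have e2 : y - 2 * (k : ℤ) - 1 - 1 = y - 2 * k - 2 := by ring
    rw [e1, e2] at h3
    exact ⟨by omega, fun _ _ => by omega⟩

/-- In neighbouring columns, contents increase with the height. -/
theorem contentAt_lt {s t : ℤ × ℤ} (hs : TileAt α s) (ht : TileAt α t) (hd : |s.1 - t.1| ≤ 1)
    (hlt : t.2 < s.2) : contentAt α t < contentAt α s := by
  obtain ⟨x, y⟩ := s
  obtain ⟨x', y'⟩ := t
  have p1 := hs.1
  have p2 := ht.1
  have q2 := ht.2.1
  have p3 := hs.2.2
  simp only at p1 p2 p3 q2 hd hlt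
  rw [Int.odd_iff] at p1 p2
  rw [abs_le] at hd
  by_cases hx : x' = x
  · subst hx
    have := (contentAt_le_of_column ((y - y') / 2).toNat hs).2 (by omega)
    have e : y - 2 * (((y - y') / 2).toNat : ℤ) = y' := by omega
    rw [e] at this
    exact this ht
  · obtain ⟨d, hd', rfl⟩ : ∃ d, (d = 1 ∨ d = -1) ∧ x' = x + d := ⟨x' - x, by omega, by omega⟩
    refine lt_of_le_of_lt ?_ (contentAt_lt_of_neighbour hd' hs)
    have hΩ : hz (maxPath (m + 1)) x - 1 ≤ hz (maxPath (m + 1)) (x + d) := by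
      rcases hd' with rfl | rfl
      · have := hz_lipschitz (maxPath (m + 1)) (show x ≤ x + 1 by omega)
        omega
      · have := hz_lipschitz (maxPath (m + 1)) (show x + -1 ≤ x by omega)
        omega
    have hmid : TileAt α (x + d, y - 1) := by
      refine ⟨?_, ?_, ?_⟩ <;> simp only
      · rw [Int.odd_iff]; omega
      · omega
      · omega
    have := (contentAt_le_of_column ((y - 1 - y') / 2).toNat hmid).1
    have e : y - 1 - 2 * (((y - 1 - y') / 2).toNat : ℤ) = y' := by omega
    rwa [e] at this

/-- The box with the coordinates of a tile. -/
def toBox (t : Fin m × ℕ) : ℤ × ℤ := ((t.1 : ℤ) + 1, (t.2 : ℤ))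

theorem toBox_injective : Function.Injective (toBox : Fin m × ℕ → ℤ × ℤ) := by
  rintro ⟨k, j⟩ ⟨k', j'⟩ h
  simp only [toBox, Prod.mk.injEq] at h
  ext <;> simp only <;> omega

theorem IsTileOrder.isTileList {L : List (Fin m × ℕ)} (hL : IsTileOrder α L) :
    IsTileList α (L.map toBox) where
  nodup := hL.nodup.map toBox_injective
  mem_iff t := by
    rw [List.mem_map]
    constructor
    · rintro ⟨s, hs, rfl⟩
      exact (isTile_iff α s.1 s.2).1 ((hL.mem_iff s).1 hs)
    · intro ht
      have hb := ht.bounds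
      push_cast at hb
      have e : toBox ((⟨(t.1 - 1).toNat, by omega⟩ : Fin m), t.2.toNat) = t := by
        ext <;> simp only [toBox] <;> omega
      exact ⟨_, (hL.mem_iff _).2 ((isTile_iff α _ _).2 (by
        have := ht
        rw [← e] at this
        exact this)), e⟩
  sorted := by
    refine List.pairwise_map.2 (hL.sorted.imp_of_mem fun {s t} hs ht hst hd => ?_)
    by_contra hc
    have h1 := (isTile_iff α s.1 s.2).1 ((hL.mem_iff s).1 hs)
    have h2 := (isTile_iff α t.1 t.2).1 ((hL.mem_iff t).1 ht)
    have h3 := contentAt_lt h1 h2 hd (not_le.1 hc)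
    rw [contentAt_fin, contentAt_fin] at h3
    omega

theorem exists_isTileOrder (α : DyckPath (m + 1)) : ∃ L, IsTileOrder α L := by
  classical
  let S : Finset (Fin m × ℕ) :=
    (Finset.univ ×ˢ Finset.range (m + 2)).filter fun t => IsTile α t.1 t.2
  have hS : ∀ t, t ∈ S ↔ IsTile α t.1 t.2 := fun t => by
    simp only [S, Finset.mem_filter, Finset.mem_product, Finset.mem_univ, Finset.mem_range,
      true_and, and_iff_right_iff_imp]
    intro ht
    have h1 := ((isTile_iff α t.1 t.2).1 ht).2.2
    rw [hz_maxPath] at h1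
    simp only at h1
    omega
  let R : Fin m × ℕ → Fin m × ℕ → Prop := fun s t => content α s.2 s.1 ≤ content α t.2 t.1
  have hp := List.perm_insertionSort R S.toList
  have : Std.Total R := ⟨fun s t => le_total _ _⟩
  have : IsTrans _ R := ⟨fun s t u h1 h2 => le_trans h1 h2⟩
  refine ⟨S.toList.insertionSort R, hp.nodup_iff.2 S.nodup_toList, fun t => ?_,
    List.pairwise_insertionSort R _⟩
  rw [hp.mem_iff, Finset.mem_toList, hS]

open Classical in
/-- A list of the tiles that starts with the tiles in the rectangle. -/
theorem IsFilling.isTileList_append (hF : IsFilling α γ i h l r) (h1 : ∀ x, hz α x ≤ hz δ x)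
    (h2 : ∀ x, hz δ x ≤ hz γ x) {L : List (ℤ × ℤ)} (hL : IsTileList γ L) :
    IsTileList δ ((rectBoxes i (h + 1) l r).filter (TileAt δ ·) ++ L) where
  nodup := by
    refine List.nodup_append.2 ⟨(rectBoxes_nodup _ _ _ _).filter _, hL.nodup, ?_⟩
    rintro s hs t ht rfl
    rw [List.mem_filter, hF.mem_rectBoxes_iff] at hs
    exact hs.1.2 ((hL.mem_iff s).1 ht)
  mem_iff t := by
    rw [List.mem_append, List.mem_filter, hF.mem_rectBoxes_iff, hL.mem_iff, decide_eq_true_eq]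
    constructor
    · rintro (h | h)
      · exact h.2
      · exact h.mono h2
    · intro h
      by_cases hγ : TileAt γ t
      · exact Or.inr hγ
      · exact Or.inl ⟨⟨h.mono h1, hγ⟩, h⟩
  sorted := by
    refine List.pairwise_append.2 ⟨(rectBoxes_boxOrder _ _ _ _).filter _, hL.sorted, ?_⟩
    intro s hs t ht hd
    rw [List.mem_filter, hF.mem_rectBoxes_iff] at hs
    have h3 := ((hL.mem_iff t).1 ht).2.1
    have h4 : s.2 ≤ hz γ s.1 := by
      by_contra hc
      exact hs.1.2 ⟨hs.1.1.1, by omega, hs.1.1.2.2⟩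
    rw [abs_le] at hd
    rcases le_total s.1 t.1 with h5 | h5
    · have := hz_lipschitz γ h5
      omega
    · have := hz_lipschitz γ h5
      omega

end

/-! ### The induction on the number of tiles -/

section

variable {m : ℕ} {α γ δ : DyckPath (m + 1)} {i h : ℤ} {l r : ℕ}

/-- The product over a list of boxes of the Baxterised elements with the contents of `δ`; boxes
that are not tiles contribute the factor `1`. -/
def tileProd {R : Type*} [Ring R] [Algebra ℂ R] (η : ℂ) (A : ℤ → R) (δ : DyckPath (m + 1))
    (L : List (ℤ × ℤ)) : R :=
  (L.map fun t => bax (weight η) A t.1 (contentAt δ t)).prod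

theorem tileProd_append {R : Type*} [Ring R] [Algebra ℂ R] (η : ℂ) (A : ℤ → R)
    (δ : DyckPath (m + 1)) (L L' : List (ℤ × ℤ)) :
    tileProd η A δ (L ++ L') = tileProd η A δ L * tileProd η A δ L' := by
  simp [tileProd]

open Classical in
theorem tileProd_filter {R : Type*} [Ring R] [Algebra ℂ R] (η : ℂ) (A : ℤ → R)
    (δ : DyckPath (m + 1)) (L : List (ℤ × ℤ)) :
    tileProd η A δ (L.filter (TileAt δ ·)) = tileProd η A δ L := by
  induction L with
  | nil => rfl
  | cons t L ih =>
    by_cases ht : TileAt δ t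
    · rw [List.filter_cons_of_pos (by simpa using ht)]
      simp only [tileProd, List.map_cons, List.prod_cons] at ih ⊢
      rw [ih]
    · rw [List.filter_cons_of_neg (by simpa using ht), ih]
      simp only [tileProd, List.map_cons, List.prod_cons]
      rw [contentAt_of_not_tileAt ht, bax_zero, one_mul]

theorem tileProd_eq_of_isTileList {R : Type*} [Ring R] [Algebra ℂ R] {η c : ℂ} {A : ℤ → R}
    {lo hi : ℤ} (hA : IsHeckeFamily c A lo hi) {L L' : List (ℤ × ℤ)} (hL : IsTileList δ L)
    (hL' : IsTileList δ L') : tileProd η A δ L = tileProd η A δ L' := by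
  refine prod_map_eq_of_perm _ BoxOrder ((List.perm_ext_iff_of_nodup hL.nodup hL'.nodup).2
    fun t => by rw [hL.mem_iff, hL'.mem_iff]) hL.sorted hL'.sorted fun s hs t ht hst hts => ?_
  by_cases hd : |s.1 - t.1| ≤ 1
  · have h2 := le_antisymm (hst hd) (hts (by rwa [abs_sub_comm]))
    have p1 := ((hL.mem_iff s).1 hs).1
    have p2 := ((hL.mem_iff t).1 ht).1
    rw [Int.odd_iff] at p1 p2
    rw [abs_le] at hd
    have : s = t := by
      rw [Prod.ext_iff]
      omega
    rw [this]
    exact Commute.refl _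
  · rw [abs_le] at hd
    exact hA.bax_commute_bax _ (by omega) _ _

theorem mul_tileProd {R : Type*} [Ring R] [Algebra ℂ R] {η : ℂ} {A : ℤ → R} {P : R}
    (L : List (ℤ × ℤ)) (hP : ∀ t ∈ L, P * A t.1 = 0) :
    P * tileProd η A δ L = (L.map fun t => weight η (contentAt δ t)).prod • P := by
  induction L with
  | nil => simp [tileProd]
  | cons t L ih =>
    have ih := ih fun s hs => hP s (List.mem_cons_of_mem _ hs)
    simp only [tileProd, List.map_cons, List.prod_cons] at ih ⊢
    have e : P * bax (weight η) A t.1 (contentAt δ t) = weight η (contentAt δ t) • P := by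
      unfold bax
      split_ifs with h0
      · rw [h0, weight_zero, mul_one, one_smul]
      · rw [mul_sub, hP t List.mem_cons_self, sub_zero, Algebra.smul_def, Algebra.commutes]
    rw [← mul_assoc, e, smul_mul_assoc, ih, smul_smul]

/-- The product of the weights in the rectangle, for given contents. -/
theorem mul_tileProd_rectBoxes {R : Type*} [Ring R] [Algebra ℂ R] {η : ℂ} {A : ℤ → R} {P : R}
    (hP : ∀ j, i - l < j → j < i + r → P * A j = 0) {G : ℕ → ℕ → ℕ}
    (hG : ∀ a b, a < l → b < r → contentAt δ (i + b - a, h + 1 + a + b) = G a b) :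
    P * tileProd η A δ (rectBoxes i (h + 1) l r) = rectWeight η l r G • P := by
  rw [mul_tileProd, prod_rectBoxes, rectWeight]
  · congr 1
    refine Finset.prod_congr rfl fun a ha => Finset.prod_congr rfl fun b hb => ?_
    rw [hG a b (Finset.mem_range.1 ha) (Finset.mem_range.1 hb)]
  · intro t ht
    obtain ⟨a, b, h1⟩ := mem_rectBoxes.1 ht
    exact hP _ (by omega) (by omega)

theorem bump_le (f : ℤ → ℤ) (x y z : ℤ) : f z ≤ bump f x y z := by
  unfold bump
  split_ifs <;> omega

theorem IsFilling.bump_le (hF : IsFilling α γ i h l r) {y : ℤ}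
    (hy : y = i ∨ (y = i + 1 ∧ 2 ≤ r) ∨ (y = i - 1 ∧ 2 ≤ l)) (x : ℤ) :
    bump (hz α) i y x ≤ hz γ x := by
  have hr := hF.right.pos
  have hl := hF.left.pos
  unfold bump
  split_ifs with hx
  · have g := hF.inside x (by omega) (by omega)
    rcases le_total i x with h1 | h1
    · have := hF.right.up x h1 (by omega)
      rcases abs_cases (x - (i + r - l)) with h4 | h4 <;> omega
    · have := hF.left.left_up (x := x) (by omega) h1
      rcases abs_cases (x - (i + r - l)) with h4 | h4 <;> omega
  · exact hF.le x

theorem IsFilling.hz_box (hF : IsFilling α γ i h l r) {a b : ℕ} (ha : a < l) (hb : b < r) :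
    hz α (i + b - a) ≤ h + a + b ∧ (a = 0 ∨ b = 0 → hz α (i + b - a) = h + a + b) ∧
      (a ≠ 0 → b ≠ 0 → hz α (i + b - a) + 2 ≤ h + a + b) := by
  rcases le_total (i + b - a) i with h1 | h1
  · have := hF.left.left_up (x := i + b - a) (by omega) h1
    omega
  · have := hF.right.up (i + b - a) h1 (by omega)
    omega

theorem IsFilling.contentAt_min (hF : IsFilling α γ i h l r) (a b : ℕ) (ha : a < l) (hb : b < r) :
    contentAt α (i + b - a, h + 1 + a + b) = a + b + 1 := by
  refine hF.contentAt_rect (G := fun a b => a + b + 1) (fun _ => le_rfl) (fun a b ha hb hc => ?_)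
    (fun a b ha hb _ => ?_) _ a b rfl ha hb
  · have := hF.hz_box ha hb
    omega
  · split_ifs <;> omega

theorem IsFilling.contentAt_raise (hF : IsFilling α γ i h l r) (hδ : hz δ = bump (hz α) i i)
    (a b : ℕ) (ha : a < l) (hb : b < r) :
    contentAt δ (i + b - a, h + 1 + a + b) = a + b := by
  have hz' : ∀ a b, a < l → b < r → (hz δ (i + b - a) < h + 1 + a + b ↔ ¬ (a = 0 ∧ b = 0)) := by
    intro a b ha hb
    have := hF.hz_box ha hb
    rw [hδ, bump]
    split_ifs <;> omega
  refine hF.contentAt_rect (G := fun a b => a + b) (fun x => hδ ▸ QKZ.bump_le _ _ _ _)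
    (fun a b ha hb hc => ?_) (fun a b ha hb hc => ?_) _ a b rfl ha hb
  · have := hz' a b ha hb
    omega
  · rw [hz' a b ha hb] at hc
    split_ifs <;> omega

theorem IsFilling.contentAt_right (hF : IsFilling α γ i h l r)
    (hδ : hz δ = bump (hz α) i (i + 1)) (a b : ℕ) (ha : a < l) (hb : b < r) :
    contentAt δ (i + b - a, h + 1 + a + b) = if a = 0 then b - 1 else a + b := by
  have hz' : ∀ a b, a < l → b < r →
      (hz δ (i + b - a) < h + 1 + a + b ↔ ¬ (a = 0 ∧ b ≤ 1)) := by
    intro a b ha hb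
    have := hF.hz_box ha hb
    rw [hδ, bump]
    split_ifs <;> omega
  refine hF.contentAt_rect (G := fun a b => if a = 0 then b - 1 else a + b)
    (fun x => hδ ▸ QKZ.bump_le _ _ _ _)
    (fun a b ha hb hc => ?_) (fun a b ha hb hc => ?_) _ a b rfl ha hb
  · have := hz' a b ha hb
    rw [if_pos (by omega)]
    omega
  · rw [hz' a b ha hb] at hc
    split_ifs <;> omega

theorem IsFilling.contentAt_left (hF : IsFilling α γ i h l r)
    (hδ : hz δ = bump (hz α) i (i - 1)) (a b : ℕ) (ha : a < l) (hb : b < r) :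
    contentAt δ (i + b - a, h + 1 + a + b) = if b = 0 then a - 1 else a + b := by
  have hz' : ∀ a b, a < l → b < r →
      (hz δ (i + b - a) < h + 1 + a + b ↔ ¬ (b = 0 ∧ a ≤ 1)) := by
    intro a b ha hb
    have := hF.hz_box ha hb
    rw [hδ, bump]
    split_ifs <;> omega
  refine hF.contentAt_rect (G := fun a b => if b = 0 then a - 1 else a + b)
    (fun x => hδ ▸ QKZ.bump_le _ _ _ _)
    (fun a b ha hb hc => ?_) (fun a b ha hb hc => ?_) _ a b rfl ha hb
  · have := hz' a b ha hb
    rw [if_pos (by omega)]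
    omega
  · rw [hz' a b ha hb] at hc
    split_ifs <;> omega

/-- The area between the path and the maximal path. -/
def defect (α : DyckPath (m + 1)) : ℕ :=
  ∑ x ∈ Finset.range (m + 2), (hz (maxPath (m + 1)) x - hz α x).toNat

theorem defect_lt (h1 : ∀ x, hz α x ≤ hz δ x) {x : ℤ} (h0 : 0 ≤ x) (hm : x ≤ m + 1)
    (hx : hz α x < hz δ x) : defect δ < defect α := by
  obtain ⟨k, rfl⟩ := Int.eq_ofNat_of_zero_le h0
  refine Finset.sum_lt_sum (fun y _ => ?_) ⟨k, Finset.mem_range.2 (by omega), ?_⟩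
  · have := h1 y
    omega
  · have := hz_le_maxPath δ k
    omega

/-- There is no path that bumps an arm of length one at its end. -/
theorem bump_right_ne (hR : IsArm (hz α) i h 1) (β : DyckPath (m + 1)) :
    hz β ≠ bump (hz α) i (i + 1) := by
  intro hb
  have h1 := congrFun hb (i + 1)
  have h2 := congrFun hb (i + 1 + 1)
  have g1 := hR.up (i + 1) (by omega) (by push_cast; omega)
  have g2 := hR.down (i + 1 + 1) (by push_cast; omega) (by push_cast; omega)
  rw [bump, if_pos (Or.inr rfl)] at h1
  rw [bump, if_neg (by omega)] at h2
  have := hz_step β (i + 1)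
  push_cast at g2
  omega

theorem bump_left_ne (hL : IsArm (fun x => hz α (-x)) (-i) h 1) (β : DyckPath (m + 1)) :
    hz β ≠ bump (hz α) i (i - 1) := by
  intro hb
  have h1 := congrFun hb (i - 1)
  have h2 := congrFun hb (i - 1 - 1)
  have g1 := hL.left_up (x := i - 1) (by push_cast; omega) (by omega)
  have g2 := hL.left_down (x := i - 1 - 1) (by push_cast; omega) (by push_cast; omega)
  rw [bump, if_pos (Or.inr rfl)] at h1
  rw [bump, if_neg (by omega)] at h2
  have := hz_step β (i - 1 - 1)
  rw [sub_add_cancel] at this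
  push_cast at g2
  omega

theorem exists_bump {N : ℕ} {α : DyckPath N} {h : ℤ} {l r : ℕ} {i y : ℤ}
    (hR : IsArm (hz α) i h r)
    (hL : IsArm (fun x => hz α (-x)) (-i) h l)
    (hy : (y = i + 1 ∧ 2 ≤ r) ∨ (y = i - 1 ∧ 2 ≤ l)) :
    ∃ β : DyckPath N, hz β = bump (hz α) i y := by
  obtain ⟨b0, b1, b2⟩ := arms_bounds hR hL
  have hr := hR.pos
  have hl := hL.pos
  have hdist : ∀ x, x < 1 ∨ (N : ℤ) ≤ x → ¬ (x = i ∨ x = y) := fun x hx => by omega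
  refine ⟨ofFun (bump (hz α) i y) ?_ ?_ (fun x h0 h1 => ?_) fun x => ?_, ?_⟩
  · rw [bump, if_neg (hdist 0 (by omega)), hz_of_nonpos α le_rfl]
  · rw [bump, if_neg (hdist N (by omega)), hz_of_ge α le_rfl]
    ring
  · exact (hz_nonneg α h0 h1).trans (bump_le _ _ _ _)
  · have hs := hz_step α x
    have g : ∀ z, i - 2 ≤ z → z ≤ i + 2 → (i - l ≤ z → z ≤ i → hz α z = h + (i - z)) ∧
        (i ≤ z → z ≤ i + r → hz α z = h + (z - i)) := fun z _ _ =>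
      ⟨fun h1 h2 => hL.left_up h1 h2, fun h1 h2 => hR.up z h1 h2⟩
    by_cases hx : i - 2 ≤ x ∧ x + 1 ≤ i + 2
    · have g1 := g x (by omega) (by omega)
      have g2 := g (x + 1) (by omega) (by omega)
      unfold bump
      split_ifs <;> omega
    · unfold bump
      rw [if_neg (by omega), if_neg (by omega)]
      exact hs
  · funext x
    by_cases hx : x < 0 ∨ (N : ℤ) < x
    · have e : bump (hz α) i y x = hz α x := by rw [bump, if_neg (hdist x (by omega))]
      rw [e]
      rcases hx with hx | hx
      · rw [hz_of_nonpos _ hx.le, hz_of_nonpos _ hx.le]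
      · rw [hz_of_ge _ hx.le, hz_of_ge _ hx.le]
    · push Not at hx
      rw [hz_ofFun hx.1 hx.2]

variable {η lam : ℂ} {U : Set (Fin (m + 1) → ℂ)} {Ψ : (Fin (m + 1) → ℂ) → States m}

/-- The factorised formula for the component at `α`. -/
def IsFactorised (hU : IsAdmissibleDomain η lam U) (Ψ : (Fin (m + 1) → ℂ) → States m)
    (α : DyckPath (m + 1)) : Prop :=
  ∀ L, IsTileList α L → comp U Ψ α = tileProd η (aInt hU) α L (comp U Ψ (maxPath (m + 1)))

/-- For a path between `α` and `γ` the factors outside the rectangle are those of `γ`. -/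
theorem IsFilling.comp_eq (hU : IsAdmissibleDomain η lam U) (hF : IsFilling α γ i h l r)
    (h1 : ∀ x, hz α x ≤ hz δ x) (h2 : ∀ x, hz δ x ≤ hz γ x) {L : List (ℤ × ℤ)}
    (hL : IsTileList γ L) (hγ : IsFactorised hU Ψ γ) (hδ : IsFactorised hU Ψ δ) :
    comp U Ψ δ = tileProd η (aInt hU) δ (rectBoxes i (h + 1) l r) (comp U Ψ γ) := by
  classical
  rw [hδ _ (hF.isTileList_append h1 h2 hL), tileProd_append, tileProd_filter, hγ L hL,
    Module.End.mul_apply]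
  congr 2
  refine congrArg List.prod (List.map_congr_left fun t ht => ?_)
  rw [hF.contentAt_outside h1 h2 _ t.1 t.2 rfl ((hL.mem_iff t).1 ht)]

theorem aInt_comp_eq_zero (hU : IsAdmissibleDomain η lam U) (hΨ : IsQKZSolution η lam U Ψ) {x : ℤ}
    (hα : ¬ IsMaxAt (hz α) x) : aInt hU x (comp U Ψ α) = 0 := by
  unfold aInt
  split_ifs with hx
  · refine aRes_comp_eq_zero hU hΨ _ fun hc => hα ?_
    have := (isLocMax_iff _).1 hc
    have e : (((x - 1).toNat : ℕ) : ℤ) + 1 = x := by omega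
    simp only [e] at this
    exact this
  · rfl

theorem isFactorised (hq : ∀ k : ℕ, 2 ≤ k → k ≤ m + 1 → qnum η (k : ℂ) ≠ 0)
    (hU : IsAdmissibleDomain η lam U) (hΨ : IsQKZSolution η lam U Ψ) (n : ℕ) :
    ∀ α : DyckPath (m + 1), defect α = n → IsFactorised hU Ψ α := by
  induction n using Nat.strong_induction_on with
  | _ n ih =>
    intro α hn L hL
    by_cases hα : α = maxPath (m + 1)
    · subst hα
      have : L = [] := List.eq_nil_iff_forall_not_mem.2 fun t ht => by
        have := (hL.mem_iff t).1 ht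
        exact absurd (this.2.1.trans this.2.2) (lt_irrefl _)
      rw [this]
      simp [tileProd]
    obtain ⟨i, l, r, hR, hLa⟩ := exists_arms hα
    obtain ⟨b0, b1, b2⟩ := arms_bounds hR hLa
    have hr := hR.pos
    have hl := hLa.pos
    push_cast at b2
    obtain ⟨γ, hF⟩ := exists_isFilling hR hLa
    have hi := hR.up i le_rfl (by omega)
    generalize hh : hz α i = h at *
    obtain ⟨k, hk⟩ : ∃ k : Fin m, (k : ℤ) + 1 = i :=
      ⟨⟨(i - 1).toNat, by omega⟩, by simp only; omega⟩
    -- The numbers `[k]`, the weights and the Jones-Wenzl element of the interval `(i - l, i + r)`.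
    have h2 : qnum η 2 ≠ 0 := by exact_mod_cast hq 2 le_rfl (by omega)
    have hq' : ∀ k : ℕ, 1 ≤ k → k ≤ m + 1 → qnum η (k : ℂ) ≠ 0 := fun k h1 hk => by
      rcases h1.eq_or_lt with rfl | h1
      · rw [Nat.cast_one, qnum_one h2]
        exact one_ne_zero
      · exact hq k h1 hk
    have hA := isHeckeFamily_aInt hU
    have hw : IsBaxWeight (qnum η 2) (weight η) m := isBaxWeight_weight h2 hq'
    obtain ⟨P, κ, hκ, hPA, hPv⟩ := hA.exists_jonesWenzl hw (weight_ne_zero hq')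
      (x := i - l + 1) (by omega) (l + r - 1) (by omega) (by omega)
    have hPA' : ∀ j, i - l < j → j < i + r → P * aInt hU j = 0 := fun j h1 h2 =>
      hPA j (by omega) (by omega)
    have hPv' : ∀ v, (∀ j, i - l < j → j < i + r → aInt hU j v = 0) → P v = κ • v := fun v hv =>
      hPv v fun j h1 h2 => hv j (by omega) (by omega)
    -- Paths with fewer tiles.
    have hless : ∀ δ : DyckPath (m + 1), (∀ x, hz α x ≤ hz δ x) → hz α i < hz δ i →
        IsFactorised hU Ψ δ := fun δ h1 hx =>
      ih _ (hn ▸ defect_lt h1 (by omega) (by omega) hx) δ rfl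
    have hbump : ∀ y, hz α i < bump (hz α) i y i := fun y => by
      rw [bump, if_pos (Or.inl rfl)]
      omega
    have hγ : IsFactorised hU Ψ γ := hless γ hF.le
      ((hbump i).trans_le (hF.bump_le (Or.inl rfl) i))
    obtain ⟨M, hM⟩ := exists_isTileOrder γ
    have hLγ := hM.isTileList
    have hPδ : ∀ (δ : DyckPath (m + 1)) (y : ℤ), hz δ = bump (hz α) i y →
        (y = i ∨ (y = i + 1 ∧ 2 ≤ r) ∨ (y = i - 1 ∧ 2 ≤ l)) → ∀ G : ℕ → ℕ → ℕ,
        (∀ a b, a < l → b < r → contentAt δ (i + b - a, h + 1 + a + b) = G a b) →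
        P (comp U Ψ δ) = rectWeight η l r G • P (comp U Ψ γ) := by
      intro δ y hδ hy G hG
      rw [hF.comp_eq hU (fun x => hδ ▸ bump_le _ _ _ _) (fun x => hδ ▸ hF.bump_le hy x) hLγ hγ
        (hless δ (fun x => hδ ▸ bump_le _ _ _ _) (hδ ▸ hbump y)), ← Module.End.mul_apply,
        mul_tileProd_rectBoxes hPA' hG, LinearMap.smul_apply]
    -- The factorised expression `f` and the component are both determined by their images under
    -- the Jones-Wenzl element.
    obtain ⟨f, hf⟩ : ∃ f, f = tileProd η (aInt hU) α (rectBoxes i (h + 1) l r) (comp U Ψ γ) :=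
      ⟨_, rfl⟩
    suffices hfα : comp U Ψ α = f by
      classical
      have hL' := hF.isTileList_append (fun _ => le_rfl) hF.le hLγ
      rw [hfα, hf, tileProd_eq_of_isTileList hA hL hL', tileProd_append, tileProd_filter,
        hγ _ hLγ, Module.End.mul_apply]
      congr 2
      refine congrArg List.prod (List.map_congr_left fun t ht => ?_)
      rw [hF.contentAt_outside (fun _ => le_rfl) hF.le _ t.1 t.2 rfl ((hLγ.mem_iff t).1 ht)]
    have hPf : P f = rectWeight η l r (fun a b => a + b + 1) • P (comp U Ψ γ) := by
      rw [hf, ← Module.End.mul_apply, mul_tileProd_rectBoxes hPA' hF.contentAt_min,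
        LinearMap.smul_apply]
    have hκf : P f = κ • f := by
      refine hPv' f fun j h1 h2 => ?_
      have e : tileProd η (aInt hU) α (rectBoxes i (h + 1) l r) =
          boxProd (weight η) (aInt hU) h (rectBoxes i (h + 1) l r) := by
        refine congrArg List.prod (List.map_congr_left fun t ht => ?_)
        obtain ⟨a, b, ha, hb, e1, e2⟩ := mem_rectBoxes.1 ht
        have := hF.contentAt_min a b ha hb
        rw [← e1, ← e2] at this
        rw [show contentAt α t = a + b + 1 from this]
        congr 1
        omega
      rw [hf, e]
      refine hA.apply_rectBoxes_eq_zero hw h i hl hr (by omega) (by omega) (by omega)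
        (fun j' h3 h4 h5 => aInt_comp_eq_zero hU hΨ fun hc => ?_) h1 h2
      have g1 := hF.inside j' (by omega) (by omega)
      have g2 := hF.inside (j' - 1) (by omega) (by omega)
      have g3 := hF.inside (j' + 1) (by omega) (by omega)
      have c1 := hc.1
      have c2 := hc.2
      rcases lt_or_gt_of_ne h5 with h6 | h6
      · rw [abs_of_nonpos (by omega)] at g1 g3
        omega
      · rw [abs_of_nonneg (by omega)] at g1 g2
        omega
    have hκα : P (comp U Ψ α) = κ • comp U Ψ α := by
      refine hPv' _ fun j h1 h2 => aInt_comp_eq_zero hU hΨ fun hc => ?_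
      have c1 := hc.1
      have c2 := hc.2
      rcases lt_or_ge j i with h3 | h3
      · have g1 := hLa.left_up (x := j) (by omega) (by omega)
        have g2 := hLa.left_up (x := j - 1) (by omega) (by omega)
        omega
      · have g1 := hR.up j (by omega) (by omega)
        have g2 := hR.up (j + 1) (by omega) (by omega)
        omega
    have hPα : P (comp U Ψ α) = rectWeight η l r (fun a b => a + b + 1) • P (comp U Ψ γ) := by
      have hmin : IsLocMin α k := by
        rw [isLocMin_iff, hk]
        have g1 := hLa.left_up (x := i - 1) (by omega) (by omega)
        have g2 := hR.up (i + 1) (by omega) (by omega)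
        exact ⟨by omega, by omega⟩
      have hrel := aRes_comp_raise hU hΨ k hmin (by rw [hk]; exact hR) (by rw [hk]; exact hLa)
      rw [← aInt_fin hU, hk] at hrel
      have hraise := hz_raise_eq_bump k hmin
      rw [hk] at hraise
      have hPi : P (aInt hU i (comp U Ψ (raise α k hmin))) = 0 := by
        rw [← Module.End.mul_apply, hPA' i (by omega) (by omega), LinearMap.zero_apply]
      have hright : P (lookup (comp U Ψ) (bump (hz α) i (i + 1))) =
          (if r = 1 then 0 else rectWeight η l r (fun a b => if a = 0 then b - 1 else a + b)) •
            P (comp U Ψ γ) := by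
        split_ifs with hr1
        · subst hr1
          rw [lookup_of_forall_ne _ (bump_right_ne hR), map_zero, zero_smul]
        · obtain ⟨β, hβ⟩ := exists_bump hR hLa (Or.inl ⟨rfl, by omega⟩)
          rw [lookup_hz _ hβ]
          exact hPδ β _ hβ (Or.inr (Or.inl ⟨rfl, by omega⟩)) _ (hF.contentAt_right hβ)
      have hleft : P (lookup (comp U Ψ) (bump (hz α) i (i - 1))) =
          (if l = 1 then 0 else rectWeight η l r (fun a b => if b = 0 then a - 1 else a + b)) •
            P (comp U Ψ γ) := by
        split_ifs with hl1
        · subst hl1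
          rw [lookup_of_forall_ne _ (bump_left_ne hLa), map_zero, zero_smul]
        · obtain ⟨β, hβ⟩ := exists_bump hR hLa (Or.inr ⟨rfl, by omega⟩)
          rw [lookup_hz _ hβ]
          exact hPδ β _ hβ (Or.inr (Or.inr ⟨rfl, by omega⟩)) _ (hF.contentAt_left hβ)
      rw [hrel, map_sub, map_sub, map_sub, map_smul, hPi, hright, hleft,
        hPδ _ i hraise (Or.inl rfl) _ (hF.contentAt_raise hraise),
        rectWeight_relation hl hr fun k h1 h2 => hq' k h1 (by omega)]
      module
    exact smul_right_injective _ hκ (show κ • comp U Ψ α = κ • f by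
      rw [← hκα, ← hκf, hPα, hPf])

theorem factorisedOp_restrict (hU : IsAdmissibleDomain η lam U) (ψ : (Fin (m + 1) → ℂ) → ℂ)
    (L : List (Fin m × ℕ)) (hL : ∀ t ∈ L, IsTile α t.1 t.2) :
    (fun x : U => factorisedOp η α L ψ x.1) =
      tileProd η (aInt hU) α (L.map toBox) (fun x : U => ψ x.1) := by
  induction L with
  | nil => rfl
  | cons t L ih =>
    have ih := ih fun s hs => hL s (List.mem_cons_of_mem _ hs)
    have ht := (isTile_iff α t.1 t.2).1 (hL t List.mem_cons_self)
    have hne : contentAt α (toBox t) ≠ 0 := by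
      rw [toBox, contentAt_of_tileAt ht]
      omega
    simp only [factorisedOp, tileProd, List.map_cons, List.prod_cons, Module.End.mul_apply] at ih ⊢
    rw [← ih, bax_pos _ _ _ hne, LinearMap.sub_apply, Module.algebraMap_end_apply, toBox, aInt_fin,
      ← aOp_restrict, weight, contentAt_fin, if_neg (by rwa [toBox, contentAt_fin] at hne)]
    rfl

end

end QKZ

end

theorem theorem1 (m : ℕ) (η lam : ℂ)
    (hq : ∀ k : ℕ, 2 ≤ k → k ≤ m + 1 → QKZ.qnum η (k : ℂ) ≠ 0)
    (U : Set (Fin (m + 1) → ℂ)) (hU : QKZ.IsAdmissibleDomain η lam U)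
    (Ψ : (Fin (m + 1) → ℂ) → QKZ.States m) (hΨ : QKZ.IsQKZSolution η lam U Ψ)
    (α : QKZ.DyckPath (m + 1)) :
    (∃ L, QKZ.IsTileOrder α L) ∧
    ∀ L, QKZ.IsTileOrder α L →
      ∀ x ∈ U, Ψ x α = QKZ.factorisedOp η α L (fun y => Ψ y (QKZ.maxPath (m + 1))) x := by
  refine ⟨QKZ.exists_isTileOrder α, fun L hL x hx => ?_⟩
  have h1 := QKZ.isFactorised hq hU hΨ _ α rfl _ hL.isTileList
  have h2 := QKZ.factorisedOp_restrict (α := α) hU (fun y => Ψ y (QKZ.maxPath (m + 1))) L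
    fun t ht => (hL.mem_iff t).1 ht
  exact (congrFun h1 ⟨x, hx⟩).trans (congrFun h2 ⟨x, hx⟩).symm
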